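/- \textbf{Setting.} An origami $S$ with $N$ squares is obtained from $N$ unit squares by gluing the right edge of square $i$ to the left edge of square $r(i)$ and the top edge of square $i$ to the bottom edge of square $u(i)$, where $r,u$ are permutations generating a transitive group. It is a ramified cover $\rho:S\to\mathbb{R}^2/\mathbb{Z}^2$. A period of $S$ is the holonomy $v\in\mathbb{C}=\mathbb{R}^2$ of a saddle connection, i.e. of a straight segment joining two conical singularities without singularities in its interior; $S$ is primitive if its periods generate $\mathbb{Z}^2$. For $A\in SL(2,\mathbb{Z})$, $A\cdot S=S'$ means that there is an affine homeomorphism $S\to S'$ with linear part $A$. Let $\mathcal{O}$ be the orbit B7: the set of primitive origamis with $7$ squares having a single conical singularity, of angle $6\pi$, and exactly three integer Weierstrass points (fixed points, at vertices of squares, of the affine involution with linear part $-1$). For $\alpha\in\mathbb{R}$ put $$L(S,\alpha):=\limsup_{|\mathrm{Im}(v)|\to\infty}\frac{1}{|\mathrm{Re}(v)|\cdot|\mathrm{Im}(v)|},$$ where $v$ runs over the periods of the surface obtained from $S$ by normalizing its area to $1$ and rotating it counterclockwise by $\arctan\alpha$. Write $[a_1,a_2,\dots]=\cfrac{1}{a_1+\cfrac{1}{a_2+\cdots}}$,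 where an overline denotes a period that is repeated. Let $T=\begin{pmatrix}1&1\\0&1\end{pmatrix}$, $R=\begin{pmatrix}0&-1\\1&0\end{pmatrix}$ and, for $n$ even, $g(a_1,\dots,a_n)=(T^{-a_n}R)(T^{a_{n-1}}R)\cdots(T^{-a_2}R)(T^{a_1}R)$. An even loop in $\mathcal{O}$ is a pair $(X,\alpha)$ with $X\in\mathcal{O}$ and $\alpha=[\overline{a_1,\dots,a_{2N}}]$ a quadratic irrational ($N\ge 1$, $a_i\ge1$) such that $g(a_1,\dots,a_{2N})\cdot X=X$. For $j\in\mathbb{Z}/7$ let $C_j=T^j\cdot C_0$ be the origami with squares indexed by $\mathbb{Z}/7$, $r(x)=x+1$ and $u(x)=u_0(x-j)$, where $(u_0(0),\dots,u_0(6))=(4,5,6,2,3,0,1)$. (These are the one-cylinder surfaces whose horizontal saddle connections have lengths $2,2,3$, numbered so that $R\cdot C_3=C_5$.) \textbf{Lemma.} The data $(C_6,[\overline{1,3}])$ and $(C_3,[\overline{5,2}])$ define even loops in $\mathcal{O}$, and $$L(C_6,[\overline{1,3}])=\phi_1=7+14\cdot[\overline{3,1}]=\frac{7\sqrt{21}}{3},$$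 $$L(C_3,[\overline{5,2}])=14\cdot[1,\overline{5,2}]=11.832159\pm10^{-6}.$$ -/

import Mathlib

open Filter Topology Set
open scoped MatrixGroups

noncomputable section

/-! ### Origamis and their flat geometry -/

/-- An origami (square-tiled surface) with `n` unit squares: the right edge of square `i` is glued to
the left edge of square `r i`, the top edge of square `i` to the bottom edge of square `u i`. -/
structure Origami (n : ℕ) where
  /-- the right neighbour -/
  r : Equiv.Perm (Fin n)
  /-- the upper neighbour -/
  u : Equiv.Perm (Fin n)
  /-- the surface is connected -/
  connected : ∀ i j : Fin n, ∃ g ∈ Subgroup.closure ({r, u} : Set (Equiv.Perm (Fin n))), g i = j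

/-- The torus `ℝ² / ℤ²`. -/
abbrev Torus : Type := UnitAddCircle × UnitAddCircle

/-- The linear action of `SL(2, ℤ)` on the torus. -/
def torusAct (A : SL(2, ℤ)) (p : Torus) : Torus :=
  (A.1 0 0 • p.1 + A.1 0 1 • p.2, A.1 1 0 • p.1 + A.1 1 1 • p.2)

/-- The class in the torus of a vector of `ℂ = ℝ²`. -/
def torusMk (z : ℂ) : Torus := ((z.re : UnitAddCircle), (z.im : UnitAddCircle))

namespace Origami

variable {n : ℕ}

/-- `n` disjoint copies of the closed unit square. -/
abbrev Squares (n : ℕ) : Type := Fin n × unitInterval × unitInterval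

/-- The identification of the edges of the squares. -/
inductive Glue (S : Origami n) : Squares n → Squares n → Prop
  | right (i : Fin n) (y : unitInterval) : Glue S (i, 1, y) (S.r i, 0, y)
  | up (i : Fin n) (x : unitInterval) : Glue S (i, x, 1) (S.u i, x, 0)

/-- The surface, as a topological space: the quotient of the squares by the gluing
(`Quot` is the quotient by the equivalence relation generated by `Glue`). -/
def Surface (S : Origami n) : Type := Quot S.Glue

instance (S : Origami n) : TopologicalSpace S.Surface :=
  inferInstanceAs (TopologicalSpace (Quot S.Glue))

/-- The point of the surface with coordinates `(x, y)` in the square `i`. -/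
def point (S : Origami n) (i : Fin n) (x y : unitInterval) : S.Surface := Quot.mk _ (i, x, y)

/-- The ramified covering `ρ` of the torus. -/
def proj (S : Origami n) : S.Surface → Torus :=
  Quot.lift (fun p => (((p.2.1 : ℝ) : UnitAddCircle), ((p.2.2 : ℝ) : UnitAddCircle))) (by
    rintro _ _ (⟨i, y⟩ | ⟨i, x⟩)
    · simp [AddCircle.coe_period]
    · simp [AddCircle.coe_period])

/-- Turning once counterclockwise, by the angle `2π`, around the lower left corner of a square,
through the squares to the left, below it, and back. The cycles of this permutation are the vertices
of the tiling, and the cone angle at a vertex is `2π` times the length of its cycle. -/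
def turn (S : Origami n) : Equiv.Perm (Fin n) := S.u * S.r * S.u⁻¹ * S.r⁻¹

/-- The set `Σ` of conical singularities, i.e. of the vertices with cone angle different from `2π`. -/
def sing (S : Origami n) : Set S.Surface := {x | ∃ i, S.turn i ≠ i ∧ x = S.point i 0 0}

/-- `S` belongs to the stratum `ℋ(2)`: there is exactly one conical singularity, with angle `6π`. -/
def IsH2 (S : Origami n) : Prop := S.turn.IsThreeCycle

/-- `γ` is a saddle connection with period `v` (for the metric in which the squares have side `1`):
a path joining two conical singularities with no singularity in its interior, and which is a straight
segment with holonomy `v`, that is, a lift under `ρ` of the segment `t ↦ t v` of the torus. -/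
structure IsSaddleConnection (S : Origami n) (γ : C(unitInterval, S.Surface)) (v : ℂ) : Prop where
  ne_zero : v ≠ 0
  source : γ 0 ∈ S.sing
  target : γ 1 ∈ S.sing
  interior : ∀ t : unitInterval, 0 < t → t < 1 → γ t ∉ S.sing
  straight : ∀ t : unitInterval, S.proj (γ t) = torusMk (((t : ℝ) : ℂ) * v)

/-- The set of periods of saddle connections, for squares of side `1`. -/
def hol (S : Origami n) : Set ℂ := {v | ∃ γ : C(unitInterval, S.Surface), S.IsSaddleConnection γ v}

/-- The set of periods after the normalization of the total area to `1`. -/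
def normHol (S : Origami n) : Set ℂ := (fun v => v / ((Real.sqrt n : ℝ) : ℂ)) '' S.hol

/-- `S` is primitive: the periods (for squares of side `1`) generate `ℤ²`. -/
def IsPrimitive (S : Origami n) : Prop :=
  (AddSubgroup.closure S.hol : Set ℂ) = {z | ∃ a b : ℤ, z = (a : ℂ) + (b : ℂ) * Complex.I}

/-- `A · S = S'` as translation surfaces, for `A ∈ SL(2, ℤ)`: there is an affine homeomorphism from
`S` to `S'` with linear part `A`. -/
def IsImage (A : SL(2, ℤ)) (S S' : Origami n) : Prop :=
  ∃ f : S.Surface ≃ₜ S'.Surface, ∀ x, S'.proj (f x) = torusAct A (S.proj x)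

/-- `S` has exactly three integer Weierstrass points: exactly three fixed points of the hyperelliptic
involution (the affine automorphism with linear part `-1`) are vertices of the tiling. -/
def HasThreeIntegerWeierstrassPoints (S : Origami n) : Prop :=
  ∃ f : S.Surface ≃ₜ S.Surface, (∀ x, S.proj (f x) = torusAct (-1) (S.proj x)) ∧
    {x : S.Surface | f x = x ∧ S.proj x = 0}.ncard = 3

/-- The orbit B7: primitive origamis with `7` squares in `ℋ(2)` with exactly three integer
Weierstrass points. -/
def orbitB7 : Set (Origami 7) :=
  {S | S.IsPrimitive ∧ S.IsH2 ∧ S.HasThreeIntegerWeierstrassPoints}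

/-! ### The function `L` -/

/-- `limsup 1 / (|Re v| |Im v|)` as `|Im v| → ∞`, over the `v` in a set of periods. -/
def lagrangeOfPeriods (P : Set ℂ) : ENNReal :=
  limsup (fun v : ℂ => (ENNReal.ofReal (|v.re| * |v.im|))⁻¹) (comap (fun v : ℂ => |v.im|) atTop ⊓ 𝓟 P)

/-- `L(S, α) = L(r_θ · S)` with `θ = arctan α`, where `r_θ` is the rotation by the angle `θ` and `S`
is normalized to have area `1`. -/
def lagrange (S : Origami n) (α : ℝ) : ENNReal :=
  lagrangeOfPeriods ((fun v => Complex.exp ((Real.arctan α : ℝ) * Complex.I) * v) '' S.normHol)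

end Origami

/-! ### Continued fractions -/

/-- `[a₀, …, a_{n-1}] = 1 / (a₀ + 1 / (a₁ + ⋯ + 1 / a_{n-1}))`. -/
def cfTrunc : ℕ → (ℕ → ℕ) → ℝ
  | 0, _ => 0
  | n + 1, a => 1 / ((a 0 : ℝ) + cfTrunc n (fun k => a (k + 1)))

/-- The infinite continued fraction `[a₀, a₁, …]` (without integer part). -/
def cf (a : ℕ → ℕ) : ℝ := limUnder atTop (fun n => cfTrunc n a)

theorem cfTrunc_nonneg (n : ℕ) : ∀ a : ℕ → ℕ, 0 ≤ cfTrunc n a := by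
  induction n with
  | zero => intro a; simp [cfTrunc]
  | succ n ih =>
    intro a
    have := ih (fun k => a (k + 1))
    simp only [cfTrunc]
    positivity

theorem cfTrunc_dist (n : ℕ) : ∀ a : ℕ → ℕ, (∀ k, 0 < a k) →
    |cfTrunc n a - cfTrunc (n + 1) a| ≤ 2 * (1 / 2 : ℝ) ^ n := by
  induction n using Nat.strong_induction_on with
  | _ n ih =>
    intro a ha
    have h1 : ∀ k, (1 : ℝ) ≤ a k := fun k => by exact_mod_cast ha k
    match n, ih with
    | 0, _ =>
      have h0 := h1 0
      simp only [cfTrunc]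
      rw [zero_sub, abs_neg, add_zero, abs_of_nonneg (by positivity), div_le_iff₀ (by positivity)]
      norm_num
      linarith
    | 1, _ =>
      have h0 := h1 0
      have h2 := h1 1
      have p1 : 0 ≤ cfTrunc 1 a := cfTrunc_nonneg _ _
      have p2 : 0 ≤ cfTrunc 2 a := cfTrunc_nonneg _ _
      have b : ∀ m, cfTrunc (m + 1) a ≤ 1 := by
        intro m
        have := cfTrunc_nonneg m (fun k => a (k + 1))
        simp only [cfTrunc]
        rw [div_le_one (by positivity)]
        linarith
      have b1 := b 0
      have b2 := b 1
      rw [abs_le]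
      norm_num at *
      constructor <;> linarith
    | n + 2, ih =>
      have key := ih n (by omega) (fun k => a (k + 2)) (fun k => ha _)
      have q1 := cfTrunc_nonneg n (fun k => a (k + 2))
      have q2 := cfTrunc_nonneg (n + 1) (fun k => a (k + 2))
      have e : ∀ m, cfTrunc (m + 2) a
          = 1 / ((a 0 : ℝ) + 1 / ((a 1 : ℝ) + cfTrunc m (fun k => a (k + 2)))) := fun m => rfl
      rw [e n, show n + 2 + 1 = (n + 1) + 2 from rfl, e (n + 1)]
      generalize cfTrunc n (fun k => a (k + 2)) = z at *
      generalize cfTrunc (n + 1) (fun k => a (k + 2)) = w at *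
      have h0 := h1 0
      have h2 := h1 1
      generalize (a 0 : ℝ) = x at *
      generalize (a 1 : ℝ) = y at *
      have pz : 2 ≤ x * (y + z) + 1 := by nlinarith
      have pw : 2 ≤ x * (y + w) + 1 := by nlinarith
      have hz : y + z ≠ 0 := by positivity
      have hw : y + w ≠ 0 := by positivity
      have hz' : x * (y + z) + 1 ≠ 0 := by positivity
      have hw' : x * (y + w) + 1 ≠ 0 := by positivity
      have : 1 / (x + 1 / (y + z)) - 1 / (x + 1 / (y + w))
          = (z - w) / ((x * (y + z) + 1) * (x * (y + w) + 1)) := by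
        have e1 : 1 / (x + 1 / (y + z)) = (y + z) / (x * (y + z) + 1) := by
          field_simp
        have e2 : 1 / (x + 1 / (y + w)) = (y + w) / (x * (y + w) + 1) := by
          field_simp
        rw [e1, e2, div_sub_div _ _ hz' hw']
        congr 1
        ring
      have hp : (4 : ℝ) ≤ (x * (y + z) + 1) * (x * (y + w) + 1) := by nlinarith
      rw [this, abs_div, abs_of_nonneg (by linarith : (0 : ℝ) ≤ (x * (y + z) + 1) * (x * (y + w) + 1)),
        div_le_iff₀ (by linarith)]
      have hq : (0 : ℝ) ≤ (1 / 2 : ℝ) ^ n := by positivity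
      rw [pow_add]
      nlinarith

/-- For positive entries the finite continued fractions do converge to `cf a`. -/
theorem tendsto_cf (a : ℕ → ℕ) (ha : ∀ k, 0 < a k) :
    Tendsto (fun n => cfTrunc n a) atTop (𝓝 (cf a)) := by
  have hc : CauchySeq (fun n => cfTrunc n a) := by
    refine cauchySeq_of_le_geometric (1 / 2) 2 (by norm_num) (fun n => ?_)
    rw [Real.dist_eq]
    exact cfTrunc_dist n a ha
  exact hc.tendsto_limUnder

/-- The sequence of entries `b₁, …, b_m, a₁, …, a_k, a₁, …, a_k, …`. -/
def periodicSeq (pre per : List ℕ) (n : ℕ) : ℕ :=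
  if n < pre.length then pre.getD n 0 else per.getD ((n - pre.length) % per.length) 0

/-- The number `[b₁, …, b_m, a₁, …, a_k]` with pre-period `b₁, …, b_m` and period `a₁, …, a_k`. -/
def periodicCF (pre per : List ℕ) : ℝ := cf (periodicSeq pre per)

/-! ### Even loops in the orbit B7 -/

/-- `(T^{±a_n} R) ⋯ (T^{-ε a₂} R) (T^{ε a₁} R)` with alternating signs, where
`T = (1 1; 0 1)` is `ModularGroup.T` and `R = (0 -1; 1 0)` is `ModularGroup.S`. -/
def gWordAux : ℤ → List ℕ → SL(2, ℤ)
  | _, [] => 1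
  | ε, a :: l => gWordAux (-ε) l * (ModularGroup.T ^ (ε * (a : ℤ)) * ModularGroup.S)

/-- `g(a₁, …, a_n) = (T^{±a_n} R) ⋯ (T^{-a₂} R) (T^{a₁} R)`. -/
def gWord (w : List ℕ) : SL(2, ℤ) := gWordAux 1 w

/-- `α` is a quadratic irrational. -/
def IsQuadraticIrrational (α : ℝ) : Prop :=
  Irrational α ∧ ∃ a b c : ℤ, a ≠ 0 ∧ (a : ℝ) * α ^ 2 + (b : ℝ) * α + (c : ℝ) = 0

/-- The datum `(X, α)`, where `α` has the purely periodic expansion with period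
`w = (a₁, …, a_{2N})`, is an even loop in the orbit B7: `g(a₁, …, a_{2N}) · X = X`. -/
structure IsEvenLoop (X : Origami 7) (w : List ℕ) : Prop where
  mem : X ∈ Origami.orbitB7
  ne_nil : w ≠ []
  even : Even w.length
  pos : ∀ a ∈ w, 0 < a
  quadratic : IsQuadraticIrrational (periodicCF [] w)
  loop : Origami.IsImage (gWord w) X X

/-- The upper neighbours in the element `C_0` of the cusp `C`: the squares `0, …, 6` form one
horizontal cylinder, the bottom side of which is made of three horizontal saddle connections, of
lengths `2`, `2`, `3` from left to right, and the top side of the same ones in the reversed order. -/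
def cuspCUp : Equiv.Perm (Fin 7) where
  toFun := ![4, 5, 6, 2, 3, 0, 1]
  invFun := ![5, 6, 3, 4, 0, 1, 2]
  left_inv := by decide
  right_inv := by decide

theorem cuspC_connected (u : Equiv.Perm (Fin 7)) (i j : Fin 7) :
    ∃ g ∈ Subgroup.closure ({Equiv.addRight 1, u} : Set (Equiv.Perm (Fin 7))), g i = j := by
  refine ⟨Equiv.addRight 1 ^ ((j - i : Fin 7) : ℕ),
    Subgroup.pow_mem _ (Subgroup.subset_closure (by simp)) _, ?_⟩
  revert i j
  decide

/-- The elements `C_0, …, C_6` of the cusp `C` of width `7` of the orbit B7, the only one without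
horizontal saddle connections of length `1`. Here `C_j = T^j · C_0`: the top of the cylinder is
twisted by `j`. Their numbering is the one for which `R · C_3 = C_5`. -/
def cuspC (j : Fin 7) : Origami 7 where
  r := Equiv.addRight 1
  u := cuspCUp * (Equiv.addRight j)⁻¹
  connected := cuspC_connected _

/-- `φ₁ = 7 + 14 [3, 1, 3, 1, …]`. -/
def phi1 : ℝ := 7 + 14 * periodicCF [] [3, 1]

end

noncomputable section

namespace Origami

variable {n : ℕ}

/-! ### Points of the surface -/

/-! Let `α'` be the conjugate of `α`. After normalization and rotation a period `(x, y)` has real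
part proportional to `x - α y`, and the form `(x - α y)(x - α' y)` equals `n (α - α') Re Im` plus a
multiple of `Re²`. Hence `L = n |α - α'| / κ` whenever `κ` bounds the absolute value of the form
from below on all periods and is attained along periods whose real parts tend to `0`
(`lagrange_eq`).

An even loop supplies such a sequence. Its matrix `g` preserves the set of periods and the form, and
`g⁻¹` contracts `x - α y`, so the `g⁻¹`-orbit of one period of value `±κ` suffices
(`lagrange_eq_of_contraction`).

What remains is arithmetic: the minimum of `|x² + 3xy - 3y²|` on the periods of `C_6` is `3`, and
that of `|5x² + 10xy - 2y²|` on those of `C_3` is `7`. Congruences rule out most smaller values, and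
irrationality of the roots rules out `0`. The others (`1` for the first form, `5` and `-2` for the
second) are taken only on the `g`-orbits of `(±1, 0)` and, for `C_3`, `(0, ±1)`, by descent on
`|y|`. These vectors are not periods, because `C_6`, `C_3` and `C_5 = R · C_3` have no horizontal
saddle connection of length `1`.

The geometry reduces to permutations. Rotation, shear and renumbering are explicit homeomorphisms,
which makes the loop equations decidable, and whether `(1, 0)` is a period is read off `turn`; the
topological point is `not_hasPeriod_one_zero`. -/

theorem point_right (S : Origami n) (i : Fin n) (y : unitInterval) :
    S.point i 1 y = S.point (S.r i) 0 y := Quot.sound (Glue.right i y)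

theorem point_up (S : Origami n) (i : Fin n) (x : unitInterval) :
    S.point i x 1 = S.point (S.u i) x 0 := Quot.sound (Glue.up i x)

theorem exists_point (S : Origami n) (p : S.Surface) : ∃ i x y, p = S.point i x y := by
  induction p using Quot.ind with
  | mk a => exact ⟨a.1, a.2.1, a.2.2, rfl⟩

theorem proj_point (S : Origami n) (i : Fin n) (x y : unitInterval) :
    S.proj (S.point i x y) = (((x : ℝ) : UnitAddCircle), ((y : ℝ) : UnitAddCircle)) := rfl

theorem continuous_point (S : Origami n) :
    Continuous (fun p : Squares n => S.point p.1 p.2.1 p.2.2) := continuous_quot_mk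

theorem exists_point_lt_one (S : Origami n) (p : S.Surface) :
    ∃ i x y, p = S.point i x y ∧ x < 1 ∧ y < 1 := by
  have key : ∀ i y, ∀ x : unitInterval, ∃ j x', S.point i x y = S.point j x' y ∧ x' < 1 := by
    intro i y x
    rcases eq_or_ne x 1 with rfl | h
    · exact ⟨_, _, S.point_right i y, zero_lt_one⟩
    · exact ⟨_, _, rfl, lt_of_le_of_ne x.2.2 h⟩
  obtain ⟨i, x, y, rfl⟩ := S.exists_point p
  rcases eq_or_ne y 1 with rfl | h
  · rw [S.point_up]
    obtain ⟨j, x', h', hx⟩ := key (S.u i) 0 x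
    exact ⟨j, x', 0, h', hx, zero_lt_one⟩
  · obtain ⟨j, x', h', hx⟩ := key i y x
    exact ⟨j, x', y, h', hx, lt_of_le_of_ne y.2.2 h⟩

theorem unitAddCircle_coe_inj {a b : ℝ} (ha : a ∈ Ico (0 : ℝ) 1) (hb : b ∈ Ico (0 : ℝ) 1)
    (h : (a : UnitAddCircle) = b) : a = b := by
  have : Fact ((0 : ℝ) < 1) := ⟨one_pos⟩
  exact (AddCircle.coe_eq_coe_iff_of_mem_Ico (p := (1 : ℝ)) (a := 0)
    (by simpa using ha) (by simpa using hb)).1 h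

/-- The points of the surface above a given point of the torus. -/
theorem exists_eq_point_of_proj (S : Origami n) {p : S.Surface} {x y : unitInterval}
    (hx : x < 1) (hy : y < 1)
    (h : S.proj p = (((x : ℝ) : UnitAddCircle), ((y : ℝ) : UnitAddCircle))) :
    ∃ i, p = S.point i x y := by
  obtain ⟨i, x', y', rfl, hx', hy'⟩ := S.exists_point_lt_one p
  rw [proj_point, Prod.mk.injEq] at h
  have e1 : x' = x := Subtype.ext (unitAddCircle_coe_inj ⟨x'.2.1, hx'⟩ ⟨x.2.1, hx⟩ h.1)
  have e2 : y' = y := Subtype.ext (unitAddCircle_coe_inj ⟨y'.2.1, hy'⟩ ⟨y.2.1, hy⟩ h.2)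
  exact ⟨i, by rw [e1, e2]⟩

theorem exists_eq_vertex_of_proj (S : Origami n) {p : S.Surface} (h : S.proj p = 0) :
    ∃ i, p = S.point i 0 0 :=
  S.exists_eq_point_of_proj zero_lt_one zero_lt_one (by simpa [Prod.zero_eq_mk] using h)

theorem turn_up_right (S : Origami n) (i : Fin n) : S.turn (S.r (S.u i)) = S.u (S.r i) := by
  simp [turn]

theorem vertex_up_right (S : Origami n) (i : Fin n) :
    S.point (S.r (S.u i)) 0 0 = S.point (S.u (S.r i)) 0 0 := by
  rw [← point_right, ← point_up, point_right, point_up]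

theorem vertex_turn (S : Origami n) (i : Fin n) : S.point (S.turn i) 0 0 = S.point i 0 0 := by
  have h := S.vertex_up_right (S.u⁻¹ (S.r⁻¹ i))
  rw [← turn_up_right] at h
  simpa using h.symm

/-- A function of the vertices, given by a function of the squares which is constant on the cycles
of `turn`, extended to the surface by bilinear interpolation. -/
def vertexFun (S : Origami n) (c : Fin n → ℝ) (hc : ∀ i, c (S.turn i) = c i) : S.Surface → ℝ :=
  Quot.lift (fun p => (1 - (p.2.1 : ℝ)) * (1 - p.2.2) * c p.1 + p.2.1 * (1 - p.2.2) * c (S.r p.1)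
    + (1 - p.2.1) * p.2.2 * c (S.u p.1) + p.2.1 * p.2.2 * c (S.u (S.r p.1))) (by
    rintro _ _ (⟨i, y⟩ | ⟨i, x⟩)
    · simp
    -- The right end of the top edge is reached as `u (r i)` from below and as `r (u i)` from above;
    -- these squares differ by one `turn`.
    · have := hc (S.r (S.u i))
      rw [turn_up_right] at this
      simp [this])

theorem continuous_vertexFun (S : Origami n) (c : Fin n → ℝ) (hc : ∀ i, c (S.turn i) = c i) :
    Continuous (S.vertexFun c hc) := by
  refine continuous_quot_lift _ ?_
  have h1 : ∀ f : Fin n → ℝ, Continuous (fun p : Squares n => f p.1) :=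
    fun f => continuous_of_discreteTopology.comp continuous_fst
  have h2 := h1 c
  have h3 := h1 (fun i => c (S.r i))
  have h4 := h1 (fun i => c (S.u i))
  have h5 := h1 (fun i => c (S.u (S.r i)))
  fun_prop

theorem vertexFun_bottom (S : Origami n) (c : Fin n → ℝ) (hc : ∀ i, c (S.turn i) = c i)
    (i : Fin n) (x : unitInterval) :
    S.vertexFun c hc (S.point i x 0) = (1 - (x : ℝ)) * c i + x * c (S.r i) := by
  simp [vertexFun, point]

theorem vertexFun_vertex (S : Origami n) (c : Fin n → ℝ) (hc : ∀ i, c (S.turn i) = c i)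
    (i : Fin n) : S.vertexFun c hc (S.point i 0 0) = c i := by
  simp [vertexFun_bottom]

/-- Functions constant on the cycles of `turn` separate the vertices. -/
theorem eq_of_vertex_eq (S : Origami n) (c : Fin n → ℝ) (hc : ∀ i, c (S.turn i) = c i)
    {i j : Fin n} (h : S.point i 0 0 = S.point j 0 0) : c i = c j := by
  rw [← S.vertexFun_vertex c hc i, h, vertexFun_vertex]

/-- A function supported near the horizontal edges, which on the bottom edge of the square `i` is
`d i * x * (1 - x)`. -/
def edgeFun (S : Origami n) (d : Fin n → ℝ) : S.Surface → ℝ :=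
  Quot.lift (fun p => (p.2.1 : ℝ) * (1 - p.2.1) * ((1 - p.2.2) * d p.1 + p.2.2 * d (S.u p.1))) (by
    rintro _ _ (⟨i, y⟩ | ⟨i, x⟩) <;> simp)

theorem continuous_edgeFun (S : Origami n) (d : Fin n → ℝ) : Continuous (S.edgeFun d) := by
  refine continuous_quot_lift _ ?_
  have h1 : ∀ f : Fin n → ℝ, Continuous (fun p : Squares n => f p.1) :=
    fun f => continuous_of_discreteTopology.comp continuous_fst
  have h2 := h1 d
  have h3 := h1 (fun i => d (S.u i))
  fun_prop

theorem edgeFun_bottom (S : Origami n) (d : Fin n → ℝ) (i : Fin n) (x : unitInterval) :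
    S.edgeFun d (S.point i x 0) = (x : ℝ) * (1 - x) * d i := by
  simp [edgeFun, point]

/-! ### Affine homeomorphisms -/

/-- Renumbering the squares. -/
def relabelMap (S S' : Origami n) (σ : Equiv.Perm (Fin n)) (hr : ∀ i, S'.r (σ i) = σ (S.r i))
    (hu : ∀ i, S'.u (σ i) = σ (S.u i)) : S.Surface → S'.Surface :=
  Quot.lift (fun p => S'.point (σ p.1) p.2.1 p.2.2) (by
    rintro _ _ (⟨i, y⟩ | ⟨i, x⟩)
    · simp only [point_right, hr]
    · simp only [point_up, hu])

theorem continuous_relabelMap (S S' : Origami n) (σ : Equiv.Perm (Fin n))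
    (hr : ∀ i, S'.r (σ i) = σ (S.r i)) (hu : ∀ i, S'.u (σ i) = σ (S.u i)) :
    Continuous (relabelMap S S' σ hr hu) := by
  refine continuous_quot_lift _ (S'.continuous_point.comp
    (f := fun p : Squares n => (σ p.1, p.2)) ?_)
  exact (continuous_of_discreteTopology.comp continuous_fst).prodMk continuous_snd

/-- The homeomorphism induced by a renumbering of the squares. -/
def relabelHomeo (S S' : Origami n) (σ : Equiv.Perm (Fin n)) (hr : ∀ i, S'.r (σ i) = σ (S.r i))
    (hu : ∀ i, S'.u (σ i) = σ (S.u i)) : S.Surface ≃ₜ S'.Surface where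
  toFun := relabelMap S S' σ hr hu
  invFun := relabelMap S' S σ.symm
    (fun i => by simpa using congrArg σ.symm (hr (σ.symm i)).symm)
    (fun i => by simpa using congrArg σ.symm (hu (σ.symm i)).symm)
  left_inv p := by
    obtain ⟨i, x, y, rfl⟩ := S.exists_point p
    exact congrArg (fun j => S.point j x y) (σ.symm_apply_apply i)
  right_inv p := by
    obtain ⟨i, x, y, rfl⟩ := S'.exists_point p
    exact congrArg (fun j => S'.point j x y) (σ.apply_symm_apply i)
  continuous_toFun := continuous_relabelMap ..
  continuous_invFun := continuous_relabelMap ..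

theorem connected_of_mem (S : Origami n) {r u : Equiv.Perm (Fin n)}
    (hr : S.r ∈ Subgroup.closure {r, u}) (hu : S.u ∈ Subgroup.closure {r, u}) (i j : Fin n) :
    ∃ g ∈ Subgroup.closure ({r, u} : Set (Equiv.Perm (Fin n))), g i = j := by
  obtain ⟨g, hg, h⟩ := S.connected i j
  refine ⟨g, (Subgroup.closure_le _).2 ?_ hg, h⟩
  rintro _ (rfl | rfl)
  exacts [hr, hu]

/-- The origami obtained by the rotation by the angle `π / 2`. -/
def rotate (S : Origami n) : Origami n where
  r := S.u⁻¹
  u := S.r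
  connected := S.connected_of_mem (Subgroup.subset_closure (by simp))
    (by rw [← inv_inv S.u]; exact inv_mem (Subgroup.subset_closure (by simp)))

/-- The origami obtained by the horizontal shear `T`. -/
def shear (S : Origami n) : Origami n where
  r := S.r
  u := S.u * S.r⁻¹
  connected := S.connected_of_mem (Subgroup.subset_closure (by simp))
    (by
      have h1 : S.u * S.r⁻¹ ∈ Subgroup.closure {S.r, S.u * S.r⁻¹} :=
        Subgroup.subset_closure (by simp)
      have h2 : S.r ∈ Subgroup.closure {S.r, S.u * S.r⁻¹} := Subgroup.subset_closure (by simp)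
      have h := mul_mem h1 h2
      rwa [inv_mul_cancel_right] at h)

/-- The rotation by the angle `π / 2`. -/
def rotateHomeo (S : Origami n) : S.Surface ≃ₜ S.rotate.Surface where
  toFun := Quot.lift (fun p => S.rotate.point p.1 (unitInterval.symm p.2.2) p.2.1) (by
    rintro _ _ (⟨i, y⟩ | ⟨i, x⟩)
    · simp [point_up, rotate]
    · have := S.rotate.point_right (S.u i) x
      simp [rotate] at this ⊢
      exact this.symm)
  invFun := Quot.lift (fun p => S.point p.1 p.2.2 (unitInterval.symm p.2.1)) (by
    rintro _ _ (⟨i, y⟩ | ⟨i, x⟩)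
    · simp [point_up, rotate]
    · simp [point_right, rotate])
  left_inv p := by
    obtain ⟨i, x, y, rfl⟩ := S.exists_point p
    exact congrArg (fun z => S.point i x z) (unitInterval.symm_symm y)
  right_inv p := by
    obtain ⟨i, x, y, rfl⟩ := S.rotate.exists_point p
    exact congrArg (fun z => S.rotate.point i z y) (unitInterval.symm_symm x)
  continuous_toFun := continuous_quot_lift _ (S.rotate.continuous_point.comp
    (f := fun p : Squares n => (p.1, unitInterval.symm p.2.2, p.2.1)) (by fun_prop))
  continuous_invFun := continuous_quot_lift _ (S.continuous_point.comp
    (f := fun p : Squares n => (p.1, p.2.2, unitInterval.symm p.2.1)) (by fun_prop))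

theorem rotateHomeo_point (S : Origami n) (i : Fin n) (x y : unitInterval) :
    S.rotateHomeo (S.point i x y) = S.rotate.point i (unitInterval.symm y) x := rfl

/-! ### The horizontal shear as a homeomorphism -/

/-- The point of the surface with abscissa the projection of a real number to the unit interval. -/
def realPoint (S : Origami n) (i : Fin n) (x : ℝ) (y : unitInterval) : S.Surface :=
  S.point i (Set.projIcc 0 1 zero_le_one x) y

theorem realPoint_coe (S : Origami n) (i : Fin n) (x : unitInterval) (y : unitInterval) :
    S.realPoint i x y = S.point i x y := by simp [realPoint]

theorem realPoint_zero (S : Origami n) (i : Fin n) (y : unitInterval) :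
    S.realPoint i 0 y = S.point i 0 y := S.realPoint_coe i 0 y

theorem realPoint_one (S : Origami n) (i : Fin n) (y : unitInterval) :
    S.realPoint i 1 y = S.point (S.r i) 0 y := by
  rw [← point_right]; exact S.realPoint_coe i 1 y

theorem continuous_realPoint (S : Origami n) {X : Type*} [TopologicalSpace X] {i : X → Fin n}
    {x : X → ℝ} {y : X → unitInterval} (hi : Continuous i) (hx : Continuous x)
    (hy : Continuous y) : Continuous (fun p => S.realPoint (i p) (x p) (y p)) :=
  S.continuous_point.comp (f := fun p => (i p, Set.projIcc 0 1 zero_le_one (x p), y p))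
    (hi.prodMk ((continuous_projIcc.comp hx).prodMk hy))

/-- The shear on the squares. -/
def shearAux (S : Origami n) (p : Squares n) : S.shear.Surface :=
  if (p.2.1 : ℝ) + p.2.2 ≤ 1 then S.shear.realPoint p.1 (p.2.1 + p.2.2) p.2.2
  else S.shear.realPoint (S.r p.1) (p.2.1 + p.2.2 - 1) p.2.2

/-- The inverse shear on the squares. -/
def unshearAux (S : Origami n) (p : Squares n) : S.Surface :=
  if (p.2.2 : ℝ) ≤ p.2.1 then S.realPoint p.1 (p.2.1 - p.2.2) p.2.2
  else S.realPoint (S.r⁻¹ p.1) (p.2.1 - p.2.2 + 1) p.2.2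

theorem shearAux_of_le (S : Origami n) (i : Fin n) {x y : unitInterval} (h : (x : ℝ) + y ≤ 1) :
    S.shearAux (i, x, y) = S.shear.realPoint i (x + y) y := if_pos h

theorem shearAux_of_ge (S : Origami n) (i : Fin n) {x y : unitInterval} (h : 1 ≤ (x : ℝ) + y) :
    S.shearAux (i, x, y) = S.shear.realPoint (S.r i) (x + y - 1) y := by
  rcases h.eq_or_lt with h | h
  · rw [shearAux_of_le _ _ h.ge, ← h, sub_self, realPoint_one, realPoint_zero]; rfl
  · exact if_neg h.not_ge

theorem unshearAux_of_le (S : Origami n) (i : Fin n) {x y : unitInterval} (h : (y : ℝ) ≤ x) :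
    S.unshearAux (i, x, y) = S.realPoint i (x - y) y := if_pos h

theorem unshearAux_of_ge (S : Origami n) (i : Fin n) {x y : unitInterval} (h : (x : ℝ) ≤ y) :
    S.unshearAux (i, x, y) = S.realPoint (S.r⁻¹ i) (x - y + 1) y := by
  rcases h.eq_or_lt with h | h
  · rw [unshearAux_of_le _ _ h.ge, ← h, sub_self, zero_add, realPoint_one, realPoint_zero]
    simp
  · exact if_neg h.not_ge

/-- Clamping in `realPoint` makes both branches continuous on all the squares, so it suffices that
they agree on the line `x + y = 1`. -/
theorem continuous_shearAux (S : Origami n) : Continuous S.shearAux := by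
  have h1 : Continuous (fun p : Squares n => S.r p.1) :=
    continuous_of_discreteTopology.comp continuous_fst
  refine Continuous.if_le (S.shear.continuous_realPoint (by fun_prop) (by fun_prop) (by fun_prop))
    (S.shear.continuous_realPoint h1 (by fun_prop) (by fun_prop)) (by fun_prop) (by fun_prop) ?_
  rintro ⟨i, x, y⟩ h
  exact (S.shearAux_of_le i h.le).symm.trans (S.shearAux_of_ge i h.ge)

theorem continuous_unshearAux (S : Origami n) : Continuous S.unshearAux := by
  have h1 : Continuous (fun p : Squares n => S.r⁻¹ p.1) :=
    continuous_of_discreteTopology.comp continuous_fst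
  refine Continuous.if_le (S.continuous_realPoint (by fun_prop) (by fun_prop) (by fun_prop))
    (S.continuous_realPoint h1 (by fun_prop) (by fun_prop)) (by fun_prop) (by fun_prop) ?_
  rintro ⟨i, x, y⟩ h
  exact (S.unshearAux_of_le i h.le).symm.trans (S.unshearAux_of_ge i h.ge)

/-- The top edge of `i` is pushed a full unit to the right, onto the top of `r i`; this is why the
new upper neighbour is `u * r⁻¹`, which sends `r i` to `u i`. -/
theorem shearAux_glue (S : Origami n) (p q : Squares n) (h : S.Glue p q) :
    S.shearAux p = S.shearAux q := by
  obtain ⟨i, y⟩ | ⟨i, x⟩ := h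
  · rw [shearAux_of_ge _ _ (by simpa using y.2.1), shearAux_of_le _ _ (by simpa using y.2.2)]
    simp
  · rw [shearAux_of_ge _ _ (by simpa using x.2.1), shearAux_of_le _ _ (by simpa using x.2.2)]
    simp [realPoint_coe, point_up, shear]

theorem unshearAux_glue (S : Origami n) (p q : Squares n) (h : S.shear.Glue p q) :
    S.unshearAux p = S.unshearAux q := by
  obtain ⟨i, y⟩ | ⟨i, x⟩ := h
  · rw [unshearAux_of_le _ _ (by simpa using y.2.2), unshearAux_of_ge _ _ (by simpa using y.2.1)]
    simp [shear, sub_eq_neg_add]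
  · rw [unshearAux_of_ge _ _ (by simpa using x.2.2), unshearAux_of_le _ _ (by simpa using x.2.1)]
    simp [realPoint_coe, point_up, shear]

theorem realPoint_eq_mk (S : Origami n) (i : Fin n) {x : ℝ} (hx : x ∈ Icc (0 : ℝ) 1)
    (y : unitInterval) : S.realPoint i x y = Quot.mk _ (i, ⟨x, hx⟩, y) :=
  S.realPoint_coe i ⟨x, hx⟩ y

/-- The horizontal shear, as a map. -/
def shearMap (S : Origami n) : S.Surface → S.shear.Surface := Quot.lift S.shearAux S.shearAux_glue

/-- The inverse of the horizontal shear, as a map. -/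
def unshearMap (S : Origami n) : S.shear.Surface → S.Surface :=
  Quot.lift S.unshearAux S.unshearAux_glue

theorem shearMap_of_le (S : Origami n) (i : Fin n) {x : ℝ} (hx : x ∈ Icc (0 : ℝ) 1)
    {y : unitInterval} (h : x + y ≤ 1) :
    S.shearMap (S.realPoint i x y) = S.shear.realPoint i (x + y) y := by
  rw [realPoint_eq_mk _ _ hx]
  exact S.shearAux_of_le i (x := ⟨x, hx⟩) h

theorem shearMap_of_ge (S : Origami n) (i : Fin n) {x : ℝ} (hx : x ∈ Icc (0 : ℝ) 1)
    {y : unitInterval} (h : 1 ≤ x + y) :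
    S.shearMap (S.realPoint i x y) = S.shear.realPoint (S.r i) (x + y - 1) y := by
  rw [realPoint_eq_mk _ _ hx]
  exact S.shearAux_of_ge i (x := ⟨x, hx⟩) h

theorem unshearMap_of_le (S : Origami n) (i : Fin n) {x : ℝ} (hx : x ∈ Icc (0 : ℝ) 1)
    {y : unitInterval} (h : y ≤ x) :
    S.unshearMap (S.shear.realPoint i x y) = S.realPoint i (x - y) y := by
  rw [realPoint_eq_mk _ _ hx]
  exact S.unshearAux_of_le i (x := ⟨x, hx⟩) h

theorem unshearMap_of_ge (S : Origami n) (i : Fin n) {x : ℝ} (hx : x ∈ Icc (0 : ℝ) 1)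
    {y : unitInterval} (h : x ≤ y) :
    S.unshearMap (S.shear.realPoint i x y) = S.realPoint (S.r⁻¹ i) (x - y + 1) y := by
  rw [realPoint_eq_mk _ _ hx]
  exact S.unshearAux_of_ge i (x := ⟨x, hx⟩) h

theorem unshearMap_shearMap (S : Origami n) (p : S.Surface) : S.unshearMap (S.shearMap p) = p := by
  obtain ⟨i, x, y, rfl⟩ := S.exists_point p
  obtain ⟨hx, hx'⟩ := x.2
  obtain ⟨hy, hy'⟩ := y.2
  rw [← realPoint_coe]
  rcases le_total ((x : ℝ) + y) 1 with h | h
  · rw [shearMap_of_le _ _ x.2 h, unshearMap_of_le _ _ ⟨by linarith, h⟩ (by linarith)]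
    simp
  · rw [shearMap_of_ge _ _ x.2 h,
      unshearMap_of_ge _ _ ⟨by linarith, by linarith⟩ (by linarith)]
    simp [sub_sub]

theorem shearMap_unshearMap (S : Origami n) (p : S.shear.Surface) :
    S.shearMap (S.unshearMap p) = p := by
  obtain ⟨i, x, y, rfl⟩ := S.shear.exists_point p
  obtain ⟨hx, hx'⟩ := x.2
  obtain ⟨hy, hy'⟩ := y.2
  rw [← realPoint_coe]
  rcases le_total (y : ℝ) x with h | h
  · rw [unshearMap_of_le _ _ x.2 h, shearMap_of_le _ _ ⟨by linarith, by linarith⟩ (by linarith)]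
    simp
  · rw [unshearMap_of_ge _ _ x.2 h,
      shearMap_of_ge _ _ ⟨by linarith, by linarith⟩ (by linarith),
      show S.r (S.r⁻¹ i) = i from S.r.apply_symm_apply i]
    congr 1
    ring

/-- The horizontal shear `T`. -/
def shearHomeo (S : Origami n) : S.Surface ≃ₜ S.shear.Surface where
  toFun := S.shearMap
  invFun := S.unshearMap
  left_inv := S.unshearMap_shearMap
  right_inv := S.shearMap_unshearMap
  continuous_toFun := continuous_quot_lift _ S.continuous_shearAux
  continuous_invFun := continuous_quot_lift _ S.continuous_unshearAux

theorem shearHomeo_vertex (S : Origami n) (i : Fin n) :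
    S.shearHomeo (S.point i 0 0) = S.shear.point i 0 0 := by
  have : S.shearHomeo (S.point i 0 0) = S.shearAux (i, 0, 0) := rfl
  rw [this, shearAux_of_le _ _ (by simp)]
  simpa using S.shear.realPoint_coe i 0 0

theorem proj_realPoint (S : Origami n) (i : Fin n) {x : ℝ} (hx : x ∈ Icc (0 : ℝ) 1)
    (y : unitInterval) :
    S.proj (S.realPoint i x y) = ((x : UnitAddCircle), ((y : ℝ) : UnitAddCircle)) := by
  rw [realPoint_eq_mk _ _ hx]; rfl

theorem proj_shearHomeo (S : Origami n) (p : S.Surface) :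
    S.shear.proj (S.shearHomeo p) = torusAct ModularGroup.T (S.proj p) := by
  obtain ⟨i, x, y, rfl⟩ := S.exists_point p
  obtain ⟨hx, hx'⟩ := x.2
  obtain ⟨hy, hy'⟩ := y.2
  have e : S.shearHomeo (S.point i x y) = S.shearAux (i, x, y) := rfl
  rw [e, proj_point]
  rcases le_total ((x : ℝ) + y) 1 with h | h
  · rw [shearAux_of_le _ _ h, proj_realPoint _ _ ⟨by linarith, h⟩]
    simp [torusAct, ModularGroup.T]
  · rw [shearAux_of_ge _ _ h,
      proj_realPoint _ _ ⟨by linarith, by linarith⟩]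
    simp [torusAct, ModularGroup.T, AddCircle.coe_period]

theorem proj_rotateHomeo (S : Origami n) (p : S.Surface) :
    S.rotate.proj (S.rotateHomeo p) = torusAct ModularGroup.S (S.proj p) := by
  obtain ⟨i, x, y, rfl⟩ := S.exists_point p
  rw [rotateHomeo_point, proj_point, proj_point]
  simp [torusAct, ModularGroup.S, AddCircle.coe_period]

theorem proj_relabelHomeo (S S' : Origami n) (σ : Equiv.Perm (Fin n))
    (hr : ∀ i, S'.r (σ i) = σ (S.r i)) (hu : ∀ i, S'.u (σ i) = σ (S.u i)) (p : S.Surface) :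
    S'.proj (relabelHomeo S S' σ hr hu p) = S.proj p := by
  obtain ⟨i, x, y, rfl⟩ := S.exists_point p
  rfl

end Origami

/-! ### The linear action on the torus -/

theorem torusAct_mul (A B : SL(2, ℤ)) (p : Torus) :
    torusAct (A * B) p = torusAct A (torusAct B p) := by
  simp only [torusAct, Matrix.SpecialLinearGroup.coe_mul, Matrix.mul_apply, Fin.sum_univ_two,
    Prod.mk.injEq, add_smul, mul_smul, smul_add]
  constructor <;> abel

theorem torusAct_one (p : Torus) : torusAct 1 p = p := by
  simp [torusAct]

theorem torusAct_injective (A : SL(2, ℤ)) : Function.Injective (torusAct A) :=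
  Function.LeftInverse.injective (g := torusAct A⁻¹) fun p => by
    rw [← torusAct_mul, inv_mul_cancel, torusAct_one]

/-- The Gaussian integer with given coordinates. -/
def gaussInt (x y : ℤ) : ℂ := (x : ℂ) + (y : ℂ) * Complex.I

@[simp] theorem gaussInt_re (x y : ℤ) : (gaussInt x y).re = x := by simp [gaussInt]

@[simp] theorem gaussInt_im (x y : ℤ) : (gaussInt x y).im = y := by simp [gaussInt]

theorem torusMk_smul_act (A : SL(2, ℤ)) (t : ℝ) (x y : ℤ) :
    torusMk ((t : ℂ) * gaussInt (A.1 0 0 * x + A.1 0 1 * y) (A.1 1 0 * x + A.1 1 1 * y))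
      = torusAct A (torusMk ((t : ℂ) * gaussInt x y)) := by
  simp only [torusMk, torusAct, Complex.re_ofReal_mul, Complex.im_ofReal_mul, gaussInt_re,
    gaussInt_im, ← AddCircle.coe_zsmul, ← AddCircle.coe_add, zsmul_eq_mul]
  congr 2 <;> push_cast <;> ring

namespace Origami

variable {n : ℕ}

/-! ### Affine homeomorphisms and singularities -/

-- A singular point might also be represented by a regular square, since the gluing only generates
-- the equivalence relation. The indicator of non-fixed squares is constant on the cycles of `turn`,
-- so it descends to the surface and excludes this.
open Classical in
theorem point_mem_sing (S : Origami n) (i : Fin n) : S.point i 0 0 ∈ S.sing ↔ S.turn i ≠ i := by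
  refine ⟨fun ⟨j, hj, h⟩ => ?_, fun h => ⟨i, h, rfl⟩⟩
  have := S.eq_of_vertex_eq (fun i => if S.turn i ≠ i then 1 else 0)
    (fun i => by simp [(S.turn).injective.eq_iff]) h
  by_contra h'
  simp_all

theorem proj_of_mem_sing (S : Origami n) {p : S.Surface} (h : p ∈ S.sing) : S.proj p = 0 := by
  obtain ⟨i, -, rfl⟩ := h
  simp [proj_point, Prod.zero_eq_mk]

/-- There is an affine homeomorphism from `S` to `S'` with linear part `A` which preserves the
conical singularities. -/
def IsAffine (A : SL(2, ℤ)) (S S' : Origami n) : Prop :=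
  ∃ f : S.Surface ≃ₜ S'.Surface, (∀ x, S'.proj (f x) = torusAct A (S.proj x)) ∧
    ∀ x, f x ∈ S'.sing ↔ x ∈ S.sing

theorem IsAffine.isImage {A : SL(2, ℤ)} {S S' : Origami n} (h : IsAffine A S S') :
    IsImage A S S' := let ⟨f, hf, _⟩ := h; ⟨f, hf⟩

theorem IsAffine.trans {A B : SL(2, ℤ)} {S S' S'' : Origami n} (h : IsAffine A S S')
    (h' : IsAffine B S' S'') : IsAffine (B * A) S S'' := by
  obtain ⟨f, hf, hf'⟩ := h
  obtain ⟨g, hg, hg'⟩ := h'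
  exact ⟨f.trans g, fun x => by simp [hg, hf, torusAct_mul], fun x => by simp [hg', hf']⟩

theorem IsAffine.symm {A : SL(2, ℤ)} {S S' : Origami n} (h : IsAffine A S S') :
    IsAffine A⁻¹ S' S := by
  obtain ⟨f, hf, hf'⟩ := h
  refine ⟨f.symm, fun x => torusAct_injective A ?_, fun x => ?_⟩
  · rw [← hf, ← torusAct_mul, mul_inv_cancel, torusAct_one, f.apply_symm_apply]
  · rw [← hf', f.apply_symm_apply]

theorem isAffine_of_vertex {A : SL(2, ℤ)} {S S' : Origami n} (f : S.Surface ≃ₜ S'.Surface)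
    (hf : ∀ x, S'.proj (f x) = torusAct A (S.proj x)) (τ : Equiv.Perm (Fin n))
    (hτ : ∀ i, f (S.point i 0 0) = S'.point (τ i) 0 0)
    (h : ∀ i, S'.turn (τ i) = τ i ↔ S.turn i = i) : IsAffine A S S' := by
  refine ⟨f, hf, fun x => ⟨?_, ?_⟩⟩
  · rintro ⟨j, hj, e⟩
    obtain ⟨i, rfl⟩ := τ.surjective j
    rw [← hτ] at e
    exact ⟨i, fun h' => hj ((h i).2 h'), f.injective e⟩
  · rintro ⟨i, hi, rfl⟩
    exact ⟨τ i, fun h' => hi ((h i).1 h'), hτ i⟩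

theorem turn_relabel (S S' : Origami n) (σ : Equiv.Perm (Fin n))
    (hr : ∀ i, S'.r (σ i) = σ (S.r i)) (hu : ∀ i, S'.u (σ i) = σ (S.u i)) (i : Fin n) :
    S'.turn (σ i) = σ (S.turn i) := by
  have hr' : ∀ i, S'.r⁻¹ (σ i) = σ (S.r⁻¹ i) := fun i => by
    rw [Equiv.Perm.inv_eq_iff_eq, hr]; simp
  have hu' : ∀ i, S'.u⁻¹ (σ i) = σ (S.u⁻¹ i) := fun i => by
    rw [Equiv.Perm.inv_eq_iff_eq, hu]; simp
  simp only [turn, Equiv.Perm.mul_apply, hr, hu, hr', hu']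

theorem isAffine_relabel (S S' : Origami n) (σ : Equiv.Perm (Fin n))
    (hr : ∀ i, S'.r (σ i) = σ (S.r i)) (hu : ∀ i, S'.u (σ i) = σ (S.u i)) : IsAffine 1 S S' :=
  isAffine_of_vertex (relabelHomeo S S' σ hr hu)
    (fun x => by rw [proj_relabelHomeo, torusAct_one]) σ (fun i => rfl)
    fun i => by rw [turn_relabel S S' σ hr hu, σ.injective.eq_iff]

theorem isAffine_shear (S : Origami n) : IsAffine ModularGroup.T S S.shear :=
  isAffine_of_vertex S.shearHomeo S.proj_shearHomeo 1 (fun i => S.shearHomeo_vertex i)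
    fun i => by simp [turn, shear]

theorem isAffine_rotate (S : Origami n) : IsAffine ModularGroup.S S S.rotate :=
  isAffine_of_vertex S.rotateHomeo S.proj_rotateHomeo S.u⁻¹
    (fun i => by
      rw [rotateHomeo_point, unitInterval.symm_zero, point_right]; rfl)
    fun i => by
      have h : S.u (S.u⁻¹ i) = i := S.u.apply_symm_apply i
      simp only [turn, rotate, Equiv.Perm.mul_apply, inv_inv, h]
      exact S.u.eq_symm_apply

/-! ### Periods -/

theorem exists_gaussInt_of_mem_hol (S : Origami n) {v : ℂ} (h : v ∈ S.hol) :
    ∃ x y : ℤ, v = gaussInt x y := by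
  obtain ⟨γ, h⟩ := h
  have h1 := h.straight 1
  rw [S.proj_of_mem_sing h.target] at h1
  simp only [Icc.coe_one, Complex.ofReal_one, one_mul, torusMk, Prod.zero_eq_mk,
    Prod.mk.injEq] at h1
  obtain ⟨x, hx⟩ := (AddCircle.coe_eq_zero_iff (1 : ℝ)).1 h1.1.symm
  obtain ⟨y, hy⟩ := (AddCircle.coe_eq_zero_iff (1 : ℝ)).1 h1.2.symm
  refine ⟨x, y, Complex.ext ?_ ?_⟩
  · simpa using hx.symm
  · simpa using hy.symm

/-- The reversed path works: since the period is integral, `(1 - t) v` and `-t v` agree in the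
torus. -/
theorem neg_mem_hol (S : Origami n) {v : ℂ} (h : v ∈ S.hol) : -v ∈ S.hol := by
  obtain ⟨x, y, rfl⟩ := S.exists_gaussInt_of_mem_hol h
  obtain ⟨γ, h⟩ := h
  refine ⟨γ.comp ⟨unitInterval.symm, by fun_prop⟩, ?_, ?_, ?_, fun t h0 h1 => ?_, fun t => ?_⟩
  · exact neg_ne_zero.2 h.ne_zero
  · simpa using h.target
  · simpa using h.source
  · refine h.interior _ ?_ ?_
    · rw [← Subtype.coe_lt_coe] at h1 ⊢
      simpa using h1
    · rw [← Subtype.coe_lt_coe] at h0 ⊢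
      simpa using h0
  · have := h.straight (unitInterval.symm t)
    simp only [ContinuousMap.comp_apply, ContinuousMap.coe_mk, this, torusMk,
      Complex.re_ofReal_mul, Complex.im_ofReal_mul, Complex.neg_re, Complex.neg_im, gaussInt_re,
      gaussInt_im, unitInterval.coe_symm_eq]
    have key : ∀ z : ℤ, (((1 - (t : ℝ)) * z : ℝ) : UnitAddCircle) = ((t * -z : ℝ) : UnitAddCircle) := by
      intro z
      have e : ((1 - (t : ℝ)) * z : ℝ) = t * -z + z • (1 : ℝ) := by rw [zsmul_eq_mul]; ring
      rw [e, AddCircle.coe_add, AddCircle.coe_zsmul, AddCircle.coe_period, smul_zero, add_zero]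
    rw [key, key]

/-- `(x, y)` is the holonomy of a saddle connection. -/
def HasPeriod (S : Origami n) (x y : ℤ) : Prop := gaussInt x y ∈ S.hol

theorem HasPeriod.neg {S : Origami n} {x y : ℤ} (h : S.HasPeriod x y) :
    S.HasPeriod (-x) (-y) := by
  have := S.neg_mem_hol h
  rwa [show -gaussInt x y = gaussInt (-x) (-y) by simp [gaussInt]; ring] at this

theorem gaussInt_ne_zero {x y : ℤ} : gaussInt x y ≠ 0 ↔ ¬ (x = 0 ∧ y = 0) := by
  simp [Complex.ext_iff]

theorem IsAffine.hasPeriod {A : SL(2, ℤ)} {S S' : Origami n} (hA : IsAffine A S S') {x y : ℤ}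
    (h : S.HasPeriod x y) :
    S'.HasPeriod (A.1 0 0 * x + A.1 0 1 * y) (A.1 1 0 * x + A.1 1 1 * y) := by
  obtain ⟨f, hf, hs⟩ := hA
  obtain ⟨γ, h⟩ := h
  refine ⟨ContinuousMap.comp ⟨f, f.continuous⟩ γ, ?_, (hs _).2 h.source, (hs _).2 h.target,
    fun t h0 h1 h' => h.interior t h0 h1 ((hs _).1 h'), fun t => ?_⟩
  · rw [gaussInt_ne_zero]
    rintro ⟨h1, h2⟩
    have hd := A.2
    rw [Matrix.det_fin_two] at hd
    refine gaussInt_ne_zero.1 h.ne_zero ⟨?_, ?_⟩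
    · linear_combination A.1 1 1 * h1 - A.1 0 1 * h2 - x * hd
    · linear_combination A.1 0 0 * h2 - A.1 1 0 * h1 - y * hd
  · rw [torusMk_smul_act, ← h.straight]
    exact hf _

theorem IsAffine.hasPeriod_iff {A : SL(2, ℤ)} {S S' : Origami n} (hA : IsAffine A S S')
    (x y : ℤ) : S'.HasPeriod (A.1 0 0 * x + A.1 0 1 * y) (A.1 1 0 * x + A.1 1 1 * y) ↔
      S.HasPeriod x y := by
  refine ⟨fun h => ?_, hA.hasPeriod⟩
  have := hA.symm.hasPeriod h
  have hd := A.2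
  rw [Matrix.det_fin_two] at hd
  rw [Matrix.SpecialLinearGroup.SL2_inv_expl] at this
  convert this using 1
  · simp; linear_combination -x * hd
  · simp; linear_combination -y * hd

theorem hasPeriod_rotate (S : Origami n) (x y : ℤ) :
    S.rotate.HasPeriod (-y) x ↔ S.HasPeriod x y := by
  simpa [ModularGroup.S] using S.isAffine_rotate.hasPeriod_iff x y

theorem hasPeriod_shear (S : Origami n) (x y : ℤ) :
    S.shear.HasPeriod (x + y) y ↔ S.HasPeriod x y := by
  simpa [ModularGroup.T] using S.isAffine_shear.hasPeriod_iff x y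

/-! ### Horizontal saddle connections of length one -/

theorem hasPeriod_one_zero_of_turn (S : Origami n) {i : Fin n} (h : S.turn i ≠ i)
    (h' : S.turn (S.r i) ≠ S.r i) : S.HasPeriod 1 0 := by
  refine ⟨⟨fun t => S.point i t 0, S.continuous_point.comp
    (f := fun t : unitInterval => (i, t, (0 : unitInterval))) (by fun_prop)⟩, ?_, ?_, ?_, ?_, ?_⟩
  · simp [gaussInt_ne_zero]
  · exact (S.point_mem_sing i).2 h
  · show S.point i 1 0 ∈ _
    rw [point_right]
    exact (S.point_mem_sing _).2 h'
  · intro t h0 h1 h2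
    have h3 := S.proj_of_mem_sing h2
    simp only [ContinuousMap.coe_mk, proj_point, Prod.zero_eq_mk, Prod.mk.injEq] at h3
    have := unitAddCircle_coe_inj ⟨t.2.1, h1⟩ ⟨le_rfl, one_pos⟩ (h3.1.trans (by simp))
    exact h0.ne' (Subtype.ext this)
  · intro t
    simp [proj_point, torusMk, gaussInt]

-- A path over `t ↦ (t, 0)` lies on some bottom edge at each time; continuous functions on the
-- surface control which one. `edgeFun` shows that the type (singular or regular) of the right end
-- of that edge is constant for `0 < t < 1`. If it is regular, the interpolated indicator of the
-- singularities tends to `0` at `t = 1`, against the singular target. If it is singular, the left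
-- end is regular by hypothesis, and the indicator tends to `0` at `t = 0`, against the singular
-- source.
open Classical in
theorem not_hasPeriod_one_zero (S : Origami n)
    (h : ∀ i, S.turn i ≠ i → S.turn (S.r i) = S.r i) : ¬ S.HasPeriod 1 0 := by
  rintro ⟨γ, hγ⟩
  set s : Fin n → ℝ := fun i => if S.turn i ≠ i then 1 else 0 with hs
  have hc : ∀ i, s (S.turn i) = s i := fun i => by simp [hs, (S.turn).injective.eq_iff]
  have h01 : ∀ i, s i = 0 ∨ s i = 1 := fun i => by
    by_cases hi : S.turn i = i <;> simp [hs, hi]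
  have hmul : ∀ i, s i = 0 ∨ s (S.r i) = 0 := by
    intro i
    by_cases hi : S.turn i = i
    · exact Or.inl (by simp [hs, hi])
    · exact Or.inr (by simp [hs, h i hi])
  have hsing : ∀ p ∈ S.sing, S.vertexFun s hc p = 1 := by
    rintro _ ⟨i, hi, rfl⟩
    rw [vertexFun_vertex]
    simp [hs, hi]
  have hpt : ∀ t : unitInterval, t < 1 → ∃ i, γ t = S.point i t 0 := fun t ht =>
    S.exists_eq_point_of_proj ht zero_lt_one (by
      rw [hγ.straight]; simp [torusMk, gaussInt])
  set F : ℝ → unitInterval := Set.projIcc 0 1 zero_le_one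
  have hF : Continuous F := continuous_projIcc
  have hFt : ∀ t (ht : t ∈ Icc (0 : ℝ) 1), F t = ⟨t, ht⟩ := fun t ht => Set.projIcc_of_mem _ ht
  set e : ℝ → ℝ := fun t => S.edgeFun (fun i => s (S.r i)) (γ (F t)) with he
  set g : ℝ → ℝ := fun t => S.vertexFun s hc (γ (F t)) with hg
  have hec : Continuous e := (S.continuous_edgeFun _).comp (γ.continuous.comp hF)
  have hgc : Continuous g := (S.continuous_vertexFun _ _).comp (γ.continuous.comp hF)
  have hval : ∀ t ∈ Ioo (0 : ℝ) 1, (e t = 0 ∧ (g t = 0 ∨ g t = 1 - t)) ∨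
      (e t = t * (1 - t) ∧ g t = t) := by
    intro t ht
    have ht' := Ioo_subset_Icc_self ht
    obtain ⟨i, hi⟩ := hpt ⟨t, ht'⟩ ht.2
    simp only [he, hg, hFt t ht', hi, vertexFun_bottom, edgeFun_bottom]
    rcases hmul i with h1 | h1
    · rcases h01 (S.r i) with h2 | h2 <;> simp [h1, h2]
    · rcases h01 i with h2 | h2 <;> simp [h1, h2]
  -- The quotient is `s (S.r i)` for the edge `i` carrying `γ t`: continuous with values in `{0,
  -- 1}`, hence constant.
  have hconst : ∀ t ∈ Ioo (0 : ℝ) 1, ∀ t' ∈ Ioo (0 : ℝ) 1,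
      e t / (t * (1 - t)) = e t' / (t' * (1 - t')) := by
    have hne : ∀ t ∈ Ioo (0 : ℝ) 1, t * (1 - t) ≠ 0 := fun t ht =>
      mul_ne_zero ht.1.ne' (sub_pos.2 ht.2).ne'
    intro t ht t' ht'
    refine isPreconnected_Ioo.constant_of_mapsTo (T := ({0, 1} : Set ℝ))
      (f := fun t => e t / (t * (1 - t))) (Set.toFinite _).isDiscrete
      (ContinuousOn.div hec.continuousOn (by fun_prop) hne) ?_ ht ht'
    intro t ht
    rcases hval t ht with ⟨h1, -⟩ | ⟨h1, -⟩
    · simp [h1]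
    · simp [h1, div_self (hne t ht)]
  have h0 : g 0 = 1 := by
    rw [hg]; simp only [hFt 0 (by simp)]; exact hsing _ hγ.source
  have h1 : g 1 = 1 := by
    rw [hg]; simp only [hFt 1 (by simp)]; exact hsing _ hγ.target
  have hhalf : (1 / 2 : ℝ) ∈ Ioo (0 : ℝ) 1 := by norm_num
  rcases hval _ hhalf with ⟨h2, -⟩ | ⟨h2, -⟩
  · have h3 : ∀ t ∈ Ioo (0 : ℝ) 1, g t ≤ 1 - t := by
      intro t ht
      have h4 := hconst t ht _ hhalf
      have h5 : 0 < t * (1 - t) := mul_pos ht.1 (sub_pos.2 ht.2)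
      rcases hval t ht with ⟨-, h6 | h6⟩ | ⟨h6, -⟩
      · rw [h6]; linarith [ht.2]
      · exact h6.le
      · rw [h6, h2, div_self h5.ne'] at h4; norm_num at h4
    have h7 : g 1 ≤ 1 - 1 := by
      refine le_of_tendsto_of_tendsto (b := 𝓝[<] (1 : ℝ)) (hgc.continuousAt.mono_left inf_le_left)
        (g := fun t => 1 - t) (Continuous.tendsto' (by fun_prop) _ _ rfl |>.mono_left inf_le_left) ?_
      filter_upwards [Ioo_mem_nhdsLT (zero_lt_one' ℝ)] with t ht using h3 t ht
    linarith
  · have h3 : ∀ t ∈ Ioo (0 : ℝ) 1, g t ≤ t := by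
      intro t ht
      have h4 := hconst t ht _ hhalf
      rcases hval t ht with ⟨h6, -⟩ | ⟨-, h6⟩
      · rw [h6, h2] at h4; norm_num at h4
      · exact h6.le
    have h7 : g 0 ≤ 0 := by
      refine le_of_tendsto_of_tendsto (b := 𝓝[>] (0 : ℝ)) (hgc.continuousAt.mono_left inf_le_left)
        (g := fun t => t) (Continuous.tendsto' (by fun_prop) _ _ rfl |>.mono_left inf_le_left) ?_
      filter_upwards [Ioo_mem_nhdsGT (zero_lt_one' ℝ)] with t ht using h3 t ht
    linarith

end Origami

namespace Origami

/-! ### Membership in the orbit B7 -/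

theorem isH2_of_card {S : Origami 7} (h : (Finset.univ.filter fun i => S.turn i ≠ i).card = 3) :
    S.IsH2 := by
  rw [IsH2, ← card_support_eq_three_iff]
  convert h
  ext i
  simp

theorem isPrimitive_of_mem {n : ℕ} {S : Origami n} (h1 : gaussInt 1 0 ∈ AddSubgroup.closure S.hol)
    (h2 : gaussInt 0 1 ∈ AddSubgroup.closure S.hol) : S.IsPrimitive := by
  refine Set.Subset.antisymm (fun z hz => ?_) ?_
  · induction hz using AddSubgroup.closure_induction with
    | mem v hv => exact S.exists_gaussInt_of_mem_hol hv
    | zero => exact ⟨0, 0, by simp⟩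
    | add v w _ _ hv hw =>
      obtain ⟨a, b, rfl⟩ := hv
      obtain ⟨c, d, rfl⟩ := hw
      exact ⟨a + c, b + d, by push_cast; ring⟩
    | neg v _ hv =>
      obtain ⟨a, b, rfl⟩ := hv
      exact ⟨-a, -b, by push_cast; ring⟩
  · rintro _ ⟨a, b, rfl⟩
    have := add_mem (zsmul_mem h1 a) (zsmul_mem h2 b)
    simpa [gaussInt] using this

/-- The affine involution with linear part `-1`, given by a renumbering of the squares. -/
def involution {n : ℕ} (S : Origami n) (σ : Equiv.Perm (Fin n))
    (hr : ∀ i, S.r (σ i) = σ (S.rotate.rotate.r i))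
    (hu : ∀ i, S.u (σ i) = σ (S.rotate.rotate.u i)) : S.Surface ≃ₜ S.Surface :=
  S.rotateHomeo.trans (S.rotate.rotateHomeo.trans (relabelHomeo S.rotate.rotate S σ hr hu))

/-- Since `-1 = R²`, the involution is two rotations followed by the renumbering `σ`. It sends the
lower left corner of `i` to the upper right corner of `σ i`, which is the lower left corner of `u (r
(σ i))`. The function `c` selects one square in each cycle of `turn`, so that fixed vertices become
a finite count. -/
theorem hasThreeIntegerWeierstrassPoints_of {n : ℕ} (S : Origami n) (σ : Equiv.Perm (Fin n))
    (hr : ∀ i, S.r (σ i) = σ (S.rotate.rotate.r i))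
    (hu : ∀ i, S.u (σ i) = σ (S.rotate.rotate.u i)) (c : Fin n → Fin n)
    (hc : ∀ i, c (S.turn i) = c i)
    (hc' : ∀ i, i = c i ∨ i = S.turn (c i) ∨ i = S.turn (S.turn (c i)))
    (h3 : (Finset.univ.filter fun i => c i = i ∧ c (S.u (S.r (σ i))) = i).card = 3) :
    S.HasThreeIntegerWeierstrassPoints := by
  have hv : ∀ i, S.point i 0 0 = S.point (c i) 0 0 := by
    intro i
    rcases hc' i with h | h | h
    · exact congrArg (fun j => S.point j 0 0) h
    · nth_rw 1 [h]
      exact S.vertex_turn _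
    · nth_rw 1 [h]
      rw [vertex_turn, vertex_turn]
  have hinj : ∀ i j, S.point i 0 0 = S.point j 0 0 → c i = c j := by
    intro i j h
    have := S.eq_of_vertex_eq (fun i => ((c i : ℕ) : ℝ)) (fun i => by rw [hc]) h
    exact Fin.ext (by exact_mod_cast this)
  have hcc : ∀ i, c (c i) = c i := fun i => (hinj _ _ (hv i)).symm
  refine ⟨S.involution σ hr hu, fun x => ?_, ?_⟩
  · rw [show (-1 : SL(2, ℤ)) = ModularGroup.S * ModularGroup.S by
      apply Subtype.ext
      rw [Matrix.SpecialLinearGroup.coe_mul, ModularGroup.coe_S]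
      decide, torusAct_mul,
      ← proj_rotateHomeo, ← proj_rotateHomeo]
    exact proj_relabelHomeo S.rotate.rotate S σ hr hu _
  · have hf : ∀ i, S.involution σ hr hu (S.point i 0 0) = S.point (S.u (S.r (σ i))) 0 0 := by
      intro i
      have : S.involution σ hr hu (S.point i 0 0)
        = S.point (σ i) (unitInterval.symm 0) (unitInterval.symm 0) := rfl
      rw [this, unitInterval.symm_zero, point_right, point_up]
    have : {x : S.Surface | S.involution σ hr hu x = x ∧ S.proj x = 0} =
        (fun i => S.point i 0 0) ''
          (Finset.univ.filter fun i => c i = i ∧ c (S.u (S.r (σ i))) = i : Finset (Fin n)) := by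
      ext x
      simp only [mem_ofPred_eq, mem_image, Finset.coe_filter, Finset.mem_univ, true_and]
      constructor
      · rintro ⟨h1, h2⟩
        obtain ⟨i, rfl⟩ := S.exists_eq_vertex_of_proj h2
        rw [hv i] at h1 ⊢
        rw [hf] at h1
        exact ⟨c i, ⟨hcc i, by rw [hinj _ _ h1, hcc]⟩, rfl⟩
      · rintro ⟨i, ⟨-, h2⟩, rfl⟩
        refine ⟨?_, by simp [proj_point, Prod.zero_eq_mk]⟩
        rw [hf, hv, h2]
    rw [this, Set.InjOn.ncard_image, Set.ncard_coe_finset, h3]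
    intro i hi j hj h
    simp only [Finset.coe_filter, Finset.mem_univ, true_and, mem_ofPred_eq] at hi hj
    rw [← hi.1, ← hj.1]
    exact hinj _ _ h

end Origami

/-! ### The surfaces `C_6` and `C_3`: loops, small periods, membership in B7 -/

open Origami

/-- The representatives of the vertices of the origamis `cuspC j`. -/
def cuspCVertex : Fin 7 → Fin 7 := ![0, 1, 0, 3, 0, 5, 6]

/-- The bracketing is that of a composite of `IsAffine.trans`, with `1` for the renumbering. Moving
`T⁻³` to the other side means that only positive shears are needed. -/
theorem gWord_one_three_eq : gWord [1, 3] =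
    (ModularGroup.T * (ModularGroup.T * ModularGroup.T))⁻¹ *
      (1 * (ModularGroup.S * (ModularGroup.T * ModularGroup.S))) := by
  simp only [gWord, gWordAux]
  push_cast
  group

theorem gWord_five_two_eq : gWord [5, 2] =
    (ModularGroup.T * ModularGroup.T)⁻¹ *
      (1 * (ModularGroup.S * (ModularGroup.T * (ModularGroup.T * (ModularGroup.T *
        (ModularGroup.T * (ModularGroup.T * ModularGroup.S))))))) := by
  have h : ModularGroup.T ^ ((1 : ℤ) * (5 : ℕ)) = ModularGroup.T * ModularGroup.T * ModularGroup.T *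
      ModularGroup.T * ModularGroup.T := by
    rw [one_mul, zpow_natCast]
    simp only [pow_succ, pow_zero, one_mul]
  simp only [gWord, gWordAux, h]
  push_cast
  group

theorem coe_gWord_one_three : (gWord [1, 3]).1 = !![-4, 3; 1, -1] := by
  simp only [gWord, gWordAux, one_mul, Matrix.SpecialLinearGroup.coe_mul, ModularGroup.coe_T_zpow,
    ModularGroup.coe_S]
  decide

theorem coe_gWord_five_two : (gWord [5, 2]).1 = !![-11, 2; 5, -1] := by
  simp only [gWord, gWordAux, one_mul, Matrix.SpecialLinearGroup.coe_mul, ModularGroup.coe_T_zpow,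
    ModularGroup.coe_S]
  decide

/-- The permutation of `Fin 7` with given values. -/
def permOfFn (f g : Fin 7 → Fin 7) (h : ∀ i, g (f i) = i) (h' : ∀ i, f (g i) = i) :
    Equiv.Perm (Fin 7) := ⟨f, g, h, h'⟩

theorem isAffine_cuspC_six : IsAffine (gWord [1, 3]) (cuspC 6) (cuspC 6) := by
  rw [gWord_one_three_eq]
  have h1 := (((cuspC 6).isAffine_rotate.trans (isAffine_shear _)).trans (isAffine_rotate _))
  have h2 := ((cuspC 6).isAffine_shear.trans (isAffine_shear _)).trans (isAffine_shear _)
  -- An explicit renumbering identifies `R T R · C_6` with `T³ · C_6`.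
  refine (h1.trans (isAffine_relabel _ _ (permOfFn ![4, 5, 1, 0, 6, 2, 3] ![3, 2, 5, 6, 0, 1, 4]
    (by decide) (by decide)) (by decide) (by decide))).trans h2.symm

theorem isAffine_cuspC_three : IsAffine (gWord [5, 2]) (cuspC 3) (cuspC 3) := by
  rw [gWord_five_two_eq]
  have h1 := (((((((cuspC 3).isAffine_rotate.trans (isAffine_shear _)).trans
    (isAffine_shear _)).trans (isAffine_shear _)).trans (isAffine_shear _)).trans
    (isAffine_shear _)).trans (isAffine_rotate _))
  have h2 := (cuspC 3).isAffine_shear.trans (isAffine_shear _)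
  refine (h1.trans (isAffine_relabel _ _ (permOfFn ![2, 3, 0, 1, 4, 5, 6] ![2, 3, 0, 1, 4, 5, 6]
    (by decide) (by decide)) (by decide) (by decide))).trans h2.symm

theorem hasPeriod_cuspC_six (x y : ℤ) :
    (cuspC 6).HasPeriod (-4 * x + 3 * y) (x - y) ↔ (cuspC 6).HasPeriod x y := by
  rw [← isAffine_cuspC_six.hasPeriod_iff x y, coe_gWord_one_three]
  simp [sub_eq_add_neg]

theorem hasPeriod_cuspC_three (x y : ℤ) :
    (cuspC 3).HasPeriod (-11 * x + 2 * y) (5 * x - y) ↔ (cuspC 3).HasPeriod x y := by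
  rw [← isAffine_cuspC_three.hasPeriod_iff x y, coe_gWord_five_two]
  simp [sub_eq_add_neg]

theorem not_hasPeriod_cuspC_one_zero (j : Fin 7) : ¬ (cuspC j).HasPeriod 1 0 :=
  not_hasPeriod_one_zero _ (by revert j; decide)

/-- The rotation takes `C_3` to `C_5` and `(0, 1)` to `(-1, 0)`. -/
theorem not_hasPeriod_cuspC_three_zero_one : ¬ (cuspC 3).HasPeriod 0 1 := by
  rw [← hasPeriod_rotate]
  intro h
  have h' := (isAffine_relabel (cuspC 3).rotate (cuspC 5) (permOfFn ![1, 2, 3, 0, 6, 5, 4]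
    ![3, 0, 1, 2, 6, 5, 4] (by decide) (by decide)) (by decide) (by decide)).hasPeriod h.neg
  exact not_hasPeriod_cuspC_one_zero 5 (by simpa using h')

theorem hasPeriod_cuspC_six_zero_one : (cuspC 6).HasPeriod 0 1 := by
  rw [← hasPeriod_rotate]
  exact (hasPeriod_one_zero_of_turn _ (i := 2) (by decide) (by decide)).neg

/-- Under `T` and then `R`, the vector `(1, -1)` becomes `(0, -1)` and then `(1, 0)`. -/
theorem hasPeriod_cuspC_six_one_neg_one : (cuspC 6).HasPeriod 1 (-1) := by
  rw [← hasPeriod_shear, ← hasPeriod_rotate]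
  exact hasPeriod_one_zero_of_turn _ (i := 0) (by decide) (by decide)

theorem hasPeriod_cuspC_three_one_neg_one : (cuspC 3).HasPeriod 1 (-1) := by
  rw [← hasPeriod_shear, ← hasPeriod_rotate]
  exact hasPeriod_one_zero_of_turn _ (i := 0) (by decide) (by decide)

theorem hasPeriod_cuspC_three_one_one : (cuspC 3).HasPeriod 1 1 := by
  rw [← hasPeriod_rotate, ← hasPeriod_shear, ← hasPeriod_rotate]
  exact (hasPeriod_one_zero_of_turn _ (i := 1) (by decide) (by decide)).neg

theorem isPrimitive_cuspC_six : (cuspC 6).IsPrimitive := by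
  have h1 : gaussInt 0 1 ∈ AddSubgroup.closure (cuspC 6).hol :=
    AddSubgroup.subset_closure hasPeriod_cuspC_six_zero_one
  have h2 : gaussInt 1 (-1) ∈ AddSubgroup.closure (cuspC 6).hol :=
    AddSubgroup.subset_closure hasPeriod_cuspC_six_one_neg_one
  refine isPrimitive_of_mem ?_ h1
  have := add_mem h2 h1
  simpa [gaussInt] using this

theorem isPrimitive_cuspC_three : (cuspC 3).IsPrimitive := by
  have h1 : gaussInt 1 1 ∈ AddSubgroup.closure (cuspC 3).hol :=
    AddSubgroup.subset_closure hasPeriod_cuspC_three_one_one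
  have h2 : gaussInt 1 (-1) ∈ AddSubgroup.closure (cuspC 3).hol :=
    AddSubgroup.subset_closure hasPeriod_cuspC_three_one_neg_one
  -- The vectors `(1, 1)` and `(1, -1)` generate only a sublattice of index two; `(-13, 6) = g (1,
  -- -1)` has odd coordinate sum and lies outside it.
  have h3 : gaussInt (-13) 6 ∈ AddSubgroup.closure (cuspC 3).hol :=
    AddSubgroup.subset_closure
      ((hasPeriod_cuspC_three 1 (-1)).2 hasPeriod_cuspC_three_one_neg_one)
  have h4 : gaussInt 0 1 ∈ AddSubgroup.closure (cuspC 3).hol := by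
    have := add_mem (add_mem (zsmul_mem h1 4) (zsmul_mem h2 9)) h3
    convert this using 1
    simp only [gaussInt, zsmul_eq_mul]
    push_cast
    ring
  refine isPrimitive_of_mem ?_ h4
  have := add_mem h2 h4
  simpa [gaussInt] using this

theorem cuspC_six_mem_orbitB7 : cuspC 6 ∈ orbitB7 :=
  ⟨isPrimitive_cuspC_six, isH2_of_card (by decide),
    hasThreeIntegerWeierstrassPoints_of _ (permOfFn ![5, 4, 3, 2, 1, 0, 6] ![5, 4, 3, 2, 1, 0, 6]
      (by decide) (by decide)) (by decide) (by decide) cuspCVertex (by decide) (by decide)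
      (by decide)⟩

theorem cuspC_three_mem_orbitB7 : cuspC 3 ∈ orbitB7 :=
  ⟨isPrimitive_cuspC_three, isH2_of_card (by decide),
    hasThreeIntegerWeierstrassPoints_of _ (permOfFn ![2, 1, 0, 6, 5, 4, 3] ![2, 1, 0, 6, 5, 4, 3]
      (by decide) (by decide)) (by decide) (by decide) cuspCVertex (by decide) (by decide)
      (by decide)⟩

/-! ### The values of the quadratic forms on the periods -/

/-- Descent on `|y|`: `g` replaces `y` by `x - y`, and `g⁻¹` replaces it by `-x - 4y`. When `y ≠ 0`
one of them is smaller in absolute value, so the descent ends at `(±1, 0)`. -/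
theorem not_hasPeriod_cuspC_six_of_form_eq_one : ∀ (N : ℕ) (x y : ℤ), y.natAbs = N →
    x ^ 2 + 3 * x * y - 3 * y ^ 2 = 1 → ¬ (cuspC 6).HasPeriod x y := by
  intro N
  induction N using Nat.strong_induction_on with
  | _ N ih =>
    intro x y hN hf h
    rcases eq_or_ne y 0 with rfl | hy
    · have hx : x ^ 2 = 1 := by linear_combination hf
      rcases sq_eq_sq_iff_eq_or_eq_neg.1 (hx.trans (one_pow 2).symm) with rfl | rfl
      · exact not_hasPeriod_cuspC_one_zero 6 h
      · exact not_hasPeriod_cuspC_one_zero 6 (by simpa using h.neg)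
    by_cases h1 : (x - y) ^ 2 < y ^ 2
    · exact ih _ (hN ▸ Int.natAbs_lt_iff_sq_lt.2 h1) (-4 * x + 3 * y) (x - y) rfl
        (by linear_combination hf) ((hasPeriod_cuspC_six x y).2 h)
    by_cases h2 : (-x - 4 * y) ^ 2 < y ^ 2
    · refine ih _ (hN ▸ Int.natAbs_lt_iff_sq_lt.2 h2) (-x - 3 * y) (-x - 4 * y) rfl
        (by linear_combination hf) ((hasPeriod_cuspC_six _ _).1 ?_)
      convert h using 1 <;> ring
    have hy2 : 0 < y ^ 2 := by positivity
    -- If neither move shortens `y`, the signs force `(x - 2y)(x + 5y) ≥ 0`; by the equation this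
    -- product is `1 - 7y²`, which is negative.
    have h3 : 0 ≤ x * (x - 2 * y) := by nlinarith
    have h4 : 0 ≤ (x + 3 * y) * (x + 5 * y) := by nlinarith
    have h5 : 0 < x * (x + 3 * y) := by nlinarith
    rcases pos_and_pos_or_neg_and_neg_of_mul_pos h5 with ⟨hx, hx'⟩ | ⟨hx, hx'⟩
    · have h6 := nonneg_of_mul_nonneg_right h3 hx
      have h7 := nonneg_of_mul_nonneg_right h4 hx'
      nlinarith [mul_nonneg h6 h7]
    · have h6 : x - 2 * y ≤ 0 := by nlinarith
      have h7 : x + 5 * y ≤ 0 := by nlinarith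
      nlinarith [mul_nonneg_of_nonpos_of_nonpos h6 h7]

theorem Int.sq_ne_mul_sq_of_irrational {d : ℕ} (hd : Irrational (√(d : ℝ))) {x y : ℤ}
    (h : x ^ 2 = d * y ^ 2) : x = 0 ∧ y = 0 := by
  have hy : y = 0 := by
    by_contra hy
    have hy' : (|y| : ℝ) ≠ 0 := by simpa using hy
    refine hd ⟨|x| / |y|, ?_⟩
    push_cast
    rw [div_eq_iff hy', ← Real.sqrt_sq_eq_abs, ← Real.sqrt_sq_eq_abs,
      ← Real.sqrt_mul (Nat.cast_nonneg d)]
    congr 1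
    exact_mod_cast h
  subst hy
  simpa using h

theorem irrational_sqrt_21 : Irrational (√((21 : ℕ) : ℝ)) :=
  irrational_sqrt_natCast_iff.2 (by rintro ⟨k, hk⟩; have : k < 5 := by nlinarith
                                    interval_cases k <;> omega)

theorem irrational_sqrt_35 : Irrational (√((35 : ℕ) : ℝ)) :=
  irrational_sqrt_natCast_iff.2 (by rintro ⟨k, hk⟩; have : k < 6 := by nlinarith
                                    interval_cases k <;> omega)

theorem Origami.HasPeriod.ne_zero {n : ℕ} {S : Origami n} {x y : ℤ} (h : S.HasPeriod x y) :
    ¬ (x = 0 ∧ y = 0) := by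
  obtain ⟨γ, h⟩ := h
  exact gaussInt_ne_zero.1 h.ne_zero

theorem three_le_abs_form_of_hasPeriod {x y : ℤ} (h : (cuspC 6).HasPeriod x y) :
    3 ≤ |x ^ 2 + 3 * x * y - 3 * y ^ 2| := by
  by_contra! hlt
  obtain ⟨h1, h2⟩ := abs_lt.1 hlt
  -- Modulo `3` this excludes `-1` and `2`, modulo `4` it excludes `-2`; the value `0` is excluded
  -- by irrationality and `1` by descent.
  have key3 : ∀ a b : ZMod 3, a ^ 2 + 3 * a * b - 3 * b ^ 2 ≠ -1 := by decide
  have key4 : ∀ a b : ZMod 4, a ^ 2 + 3 * a * b - 3 * b ^ 2 ≠ -2 := by decide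
  have k3 := key3 x y
  have k4 := key4 x y
  obtain ⟨f, hf⟩ : ∃ f, x ^ 2 + 3 * x * y - 3 * y ^ 2 = f := ⟨_, rfl⟩
  have c3 : ((x : ZMod 3) ^ 2 + 3 * x * y - 3 * y ^ 2) = (f : ZMod 3) := by
    rw [← hf]; push_cast; ring
  have c4 : ((x : ZMod 4) ^ 2 + 3 * x * y - 3 * y ^ 2) = (f : ZMod 4) := by
    rw [← hf]; push_cast; ring
  rw [c3] at k3
  rw [c4] at k4
  rw [hf] at h1 h2
  interval_cases f
  · exact k4 (by decide)
  · exact k3 (by decide)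
  · obtain ⟨h3, h4⟩ := Int.sq_ne_mul_sq_of_irrational irrational_sqrt_21 (x := 2 * x + 3 * y)
      (y := y) (by push_cast; linear_combination 4 * hf)
    exact h.ne_zero ⟨by omega, h4⟩
  · exact not_hasPeriod_cuspC_six_of_form_eq_one _ x y rfl hf h
  · exact k3 (by decide)

/-- The same descent, stopped at `|y| ≤ 1`. The terminal vectors are `±(1, 0)`, `±(0, 1)` and `±(2,
-1)`, the last being `±g (0, 1)`. -/
theorem not_hasPeriod_cuspC_three_of_form_eq : ∀ (N : ℕ) (x y : ℤ), y.natAbs = N →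
    (5 * x ^ 2 + 10 * x * y - 2 * y ^ 2 = 5 ∨ 5 * x ^ 2 + 10 * x * y - 2 * y ^ 2 = -2) →
    ¬ (cuspC 3).HasPeriod x y := by
  intro N
  induction N using Nat.strong_induction_on with
  | _ N ih =>
    intro x y hN hf h
    have base : ¬ (cuspC 3).HasPeriod 2 (-1) := by
      have := (hasPeriod_cuspC_three 0 1).not.2 not_hasPeriod_cuspC_three_zero_one
      simpa using this
    by_cases hy : y.natAbs ≤ 1
    · have hy' : y = 0 ∨ y = 1 ∨ y = -1 := by omega
      rcases hy' with rfl | rfl | rfl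
      · rcases hf with hf | hf
        · have hx : x ^ 2 = 1 := by linarith
          rcases sq_eq_sq_iff_eq_or_eq_neg.1 (hx.trans (one_pow 2).symm) with rfl | rfl
          · exact not_hasPeriod_cuspC_one_zero 3 h
          · exact not_hasPeriod_cuspC_one_zero 3 (by simpa using h.neg)
        · nlinarith [sq_nonneg x]
      · rcases hf with hf | hf
        · ring_nf at hf; omega
        · have hx : x * (x + 2) = 0 := by linarith
          rcases mul_eq_zero.1 hx with rfl | hx
          · exact not_hasPeriod_cuspC_three_zero_one h
          · obtain rfl : x = -2 := by omega
            exact base (by simpa using h.neg)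
      · rcases hf with hf | hf
        · ring_nf at hf; omega
        · have hx : x * (x - 2) = 0 := by linarith
          rcases mul_eq_zero.1 hx with rfl | hx
          · exact not_hasPeriod_cuspC_three_zero_one (by simpa using h.neg)
          · obtain rfl : x = 2 := by omega
            exact base h
    by_cases h1 : (5 * x - y) ^ 2 < y ^ 2
    · exact ih _ (hN ▸ Int.natAbs_lt_iff_sq_lt.2 h1) (-11 * x + 2 * y) (5 * x - y) rfl
        (hf.imp (fun hf => by linear_combination hf) (fun hf => by linear_combination hf))
        ((hasPeriod_cuspC_three x y).2 h)
    by_cases h2 : (-5 * x - 11 * y) ^ 2 < y ^ 2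
    · refine ih _ (hN ▸ Int.natAbs_lt_iff_sq_lt.2 h2) (-x - 2 * y) (-5 * x - 11 * y) rfl
        (hf.imp (fun hf => by linear_combination hf) (fun hf => by linear_combination hf))
        ((hasPeriod_cuspC_three _ _).1 ?_)
      convert h using 1 <;> ring
    -- If neither move shortens `y`, then `(5x - 2y)(5x + 12y) ≥ 0`, while the equation bounds this
    -- product by `25 - 14y²`. This is negative for `|y| ≥ 2` but not for `|y| = 1`, hence the
    -- separate base case.
    have hy2 : 2 ^ 2 ≤ y ^ 2 := by
      rw [← Int.natAbs_le_iff_sq_le]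
      omega
    have hf' : 5 * (x * (x + 2 * y)) ≤ 2 * y ^ 2 + 5 ∧ 0 < x * (x + 2 * y) := by
      rcases hf with hf | hf
      · constructor <;> nlinarith
      · constructor <;> nlinarith
    have h3 : 0 ≤ x * (5 * x - 2 * y) := by nlinarith
    have h4 : 0 ≤ (x + 2 * y) * (5 * x + 12 * y) := by nlinarith
    rcases pos_and_pos_or_neg_and_neg_of_mul_pos hf'.2 with ⟨hx, hx'⟩ | ⟨hx, hx'⟩
    · have h6 := nonneg_of_mul_nonneg_right h3 hx
      have h7 := nonneg_of_mul_nonneg_right h4 hx'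
      nlinarith [mul_nonneg h6 h7]
    · have h6 : 5 * x - 2 * y ≤ 0 := by nlinarith
      have h7 : 5 * x + 12 * y ≤ 0 := by nlinarith
      nlinarith [mul_nonneg_of_nonpos_of_nonpos h6 h7]

theorem seven_le_abs_form_of_hasPeriod {x y : ℤ} (h : (cuspC 3).HasPeriod x y) :
    7 ≤ |5 * x ^ 2 + 10 * x * y - 2 * y ^ 2| := by
  by_contra! hlt
  obtain ⟨h1, h2⟩ := abs_lt.1 hlt
  -- Among the values from `-6` to `6`, these congruences leave only `-2`, `0` and `5`.
  have k5 : ∀ a b : ZMod 5, 5 * a ^ 2 + 10 * a * b - 2 * b ^ 2 ∉ ({1, 4} : Finset (ZMod 5)) := by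
    decide
  have k7 : ∀ a b : ZMod 7, 5 * a ^ 2 + 10 * a * b - 2 * b ^ 2 ∉ ({2, 4} : Finset (ZMod 7)) := by
    decide
  have k9 : ∀ a b : ZMod 9, 5 * a ^ 2 + 10 * a * b - 2 * b ^ 2 ≠ 3 := by decide
  replace k5 := k5 x y
  replace k7 := k7 x y
  replace k9 := k9 x y
  obtain ⟨f, hf⟩ : ∃ f, 5 * x ^ 2 + 10 * x * y - 2 * y ^ 2 = f := ⟨_, rfl⟩
  have c5 : (5 * (x : ZMod 5) ^ 2 + 10 * x * y - 2 * y ^ 2) = (f : ZMod 5) := by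
    rw [← hf]; push_cast; ring
  have c7 : (5 * (x : ZMod 7) ^ 2 + 10 * x * y - 2 * y ^ 2) = (f : ZMod 7) := by
    rw [← hf]; push_cast; ring
  have c9 : (5 * (x : ZMod 9) ^ 2 + 10 * x * y - 2 * y ^ 2) = (f : ZMod 9) := by
    rw [← hf]; push_cast; ring
  rw [c5] at k5
  rw [c7] at k7
  rw [c9] at k9
  rw [hf] at h1 h2
  interval_cases f
  · exact k5 (by decide)
  · exact k7 (by decide)
  · exact k5 (by decide)
  · exact k7 (by decide)
  · exact not_hasPeriod_cuspC_three_of_form_eq _ x y rfl (Or.inr hf) h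
  · exact k5 (by decide)
  -- Completing the square: five times the form is `(5x + 5y)² - 35y²`.
  · obtain ⟨h3, h4⟩ := Int.sq_ne_mul_sq_of_irrational irrational_sqrt_35 (x := 5 * x + 5 * y)
      (y := y) (by push_cast; linear_combination 5 * hf)
    exact h.ne_zero ⟨by omega, h4⟩
  · exact k5 (by decide)
  · exact k7 (by decide)
  · exact k9 (by decide)
  · exact k5 (by decide)
  · exact not_hasPeriod_cuspC_three_of_form_eq _ x y rfl (Or.inl hf) h
  · exact k5 (by decide)

/-! ### Periodic continued fractions -/

theorem cf_nonneg (a : ℕ → ℕ) (ha : ∀ k, 0 < a k) : 0 ≤ cf a :=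
  ge_of_tendsto' (tendsto_cf a ha) fun n => cfTrunc_nonneg n a

theorem cf_eq (a : ℕ → ℕ) (ha : ∀ k, 0 < a k) :
    cf a = 1 / ((a 0 : ℝ) + cf (fun k => a (k + 1))) := by
  have h0 : (0 : ℝ) < a 0 := by exact_mod_cast ha 0
  have h1 := cf_nonneg (fun k => a (k + 1)) fun k => ha _
  refine tendsto_nhds_unique ((tendsto_add_atTop_iff_nat 1).2 (tendsto_cf a ha)) ?_
  exact tendsto_const_nhds.div ((tendsto_cf (fun k => a (k + 1)) fun k => ha _).const_add _)
    (by positivity)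

theorem periodicSeq_two_pos {a b : ℕ} (ha : 0 < a) (hb : 0 < b) (k : ℕ) :
    0 < periodicSeq [] [a, b] k := by
  have : k % 2 = 0 ∨ k % 2 = 1 := by omega
  rcases this with h | h <;> simp [periodicSeq, h, ha, hb]

theorem periodicCF_two {a b : ℕ} (ha : 0 < a) (hb : 0 < b) :
    periodicCF [] [a, b] = 1 / ((a : ℝ) + 1 / ((b : ℝ) + periodicCF [] [a, b])) := by
  have h := periodicSeq_two_pos ha hb
  conv_lhs => rw [periodicCF, cf_eq _ h, cf_eq _ fun k => h (k + 1)]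
  have e : (fun k => periodicSeq [] [a, b] (k + 1 + 1)) = periodicSeq [] [a, b] := by
    funext k
    simp [periodicSeq, add_assoc]
  rw [e]
  simp [periodicSeq, periodicCF]

theorem periodicCF_two_nonneg {a b : ℕ} (ha : 0 < a) (hb : 0 < b) : 0 ≤ periodicCF [] [a, b] :=
  cf_nonneg _ (periodicSeq_two_pos ha hb)

theorem periodicCF_cons_two {c a b : ℕ} (hc : 0 < c) (ha : 0 < a) (hb : 0 < b) :
    periodicCF [c] [a, b] = 1 / ((c : ℝ) + periodicCF [] [a, b]) := by
  have e : ∀ k, periodicSeq [c] [a, b] (k + 1) = periodicSeq [] [a, b] k := fun k => by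
    simp [periodicSeq]
  have h : ∀ k, 0 < periodicSeq [c] [a, b] k := by
    rintro (_ | k)
    · simpa [periodicSeq] using hc
    · rw [e]
      exact periodicSeq_two_pos ha hb k
  rw [periodicCF, cf_eq _ h, funext e]
  simp [periodicSeq, periodicCF]

/-- The quadratic equation of a continued fraction with a period of length two. -/
theorem periodicCF_two_quadratic {a b : ℕ} (ha : 0 < a) (hb : 0 < b) :
    a * periodicCF [] [a, b] ^ 2 + a * b * periodicCF [] [a, b] - b = 0 := by
  have h := periodicCF_two ha hb
  have h0 := periodicCF_two_nonneg ha hb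
  generalize periodicCF [] [a, b] = x at *
  have ha' : (0 : ℝ) < a := by exact_mod_cast ha
  have hb' : (0 : ℝ) < b := by exact_mod_cast hb
  have h1 : (b : ℝ) + x ≠ 0 := by positivity
  have h2 : (a : ℝ) * (b + x) + 1 ≠ 0 := by positivity
  have e : 1 / ((a : ℝ) + 1 / (b + x)) = (b + x) / (a * (b + x) + 1) := by field_simp
  rw [e, eq_div_iff h2] at h
  linear_combination h

theorem periodicCF_two_eq {a b : ℕ} (ha : 0 < a) (hb : 0 < b) :
    periodicCF [] [a, b] = (-(a * b) + √((a * b : ℝ) ^ 2 + 4 * (a * b))) / (2 * a) := by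
  have h := periodicCF_two_quadratic ha hb
  have h0 := periodicCF_two_nonneg ha hb
  generalize periodicCF [] [a, b] = x at *
  have ha' : (0 : ℝ) < a := by exact_mod_cast ha
  have e : √((a * b : ℝ) ^ 2 + 4 * (a * b)) = 2 * a * x + a * b := by
    rw [Real.sqrt_eq_iff_mul_self_eq (by positivity) (by positivity)]
    linear_combination (-4 * a) * h
  rw [e]
  field_simp
  ring

theorem periodicCF_one_three : periodicCF [] [1, 3] = (-3 + √21) / 2 := by
  rw [periodicCF_two_eq (by norm_num) (by norm_num)]
  norm_num

theorem periodicCF_three_one : periodicCF [] [3, 1] = (-3 + √21) / 6 := by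
  rw [periodicCF_two_eq (by norm_num) (by norm_num)]
  norm_num

theorem periodicCF_five_two : periodicCF [] [5, 2] = -1 + √35 / 5 := by
  rw [periodicCF_two_eq (by norm_num) (by norm_num)]
  have : √(140 : ℝ) = 2 * √35 := by
    rw [show (140 : ℝ) = 2 ^ 2 * 35 by norm_num, Real.sqrt_mul (by norm_num),
      Real.sqrt_sq (by norm_num)]
  norm_num [this]
  ring

theorem periodicCF_one_five_two : periodicCF [1] [5, 2] = √35 / 7 := by
  rw [periodicCF_cons_two (by norm_num) (by norm_num) (by norm_num), periodicCF_five_two]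
  have h : (0 : ℝ) < √35 := by positivity
  have h2 : √35 ^ 2 = (35 : ℝ) := Real.sq_sqrt (by norm_num)
  push_cast
  rw [add_neg_cancel_left, one_div_div, div_eq_div_iff h.ne' (by norm_num)]
  linarith

namespace Origami

/-! ### Evaluation of `L` by means of an indefinite quadratic form -/

/-- For `Re` small the term `E Re²` is at most `ε`, so `|K Re Im| ≥ κ - ε`. For `Re` bounded away
from `0` the product is large as soon as `|Im|` is. Then `ε` tends to `0`. -/
theorem lagrangeOfPeriods_le {P : Set ℂ} {K E κ : ℝ} (hK : K ≠ 0) (hκ : 0 < κ)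
    (hlow : ∀ w ∈ P, κ ≤ |K * (w.re * w.im) + E * w.re ^ 2|) :
    lagrangeOfPeriods P ≤ ENNReal.ofReal (|K| / κ) := by
  have hK' : 0 < |K| := abs_pos.2 hK
  have key : ∀ ε ∈ Ioo 0 κ, lagrangeOfPeriods P ≤ ENNReal.ofReal (|K| / (κ - ε)) := by
    rintro ε ⟨hε, hεκ⟩
    have hκε : 0 < κ - ε := sub_pos.2 hεκ
    -- The threshold makes `|E| Re² ≤ ε` for `|Re| ≤ η`; the `+ 1` allows `E = 0`.
    set η : ℝ := √(ε / (|E| + 1))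
    have hη : 0 < η := Real.sqrt_pos.2 (by positivity)
    have hη2 : η ^ 2 = ε / (|E| + 1) := Real.sq_sqrt (by positivity)
    refine limsup_le_of_le (h := ?_)
    rw [eventually_inf_principal]
    filter_upwards [tendsto_comap.eventually (eventually_ge_atTop (κ / (|K| * η)))] with w hw hwP
    have hprod : (κ - ε) / |K| ≤ |w.re| * |w.im| := by
      rw [div_le_iff₀ hK']
      rcases le_total |w.re| η with h | h
      · have h1 : |E| * w.re ^ 2 ≤ ε := by
          have h2 : w.re ^ 2 ≤ ε / (|E| + 1) := by
            rw [← hη2, ← sq_abs]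
            gcongr
          rw [le_div_iff₀ (by positivity)] at h2
          nlinarith [sq_nonneg w.re]
        have h3 := (hlow w hwP).trans (abs_add_le _ _)
        rw [abs_mul, abs_mul, abs_mul, abs_of_nonneg (sq_nonneg w.re)] at h3
        linarith
      · rw [div_le_iff₀ (by positivity)] at hw
        have : |w.im| * (|K| * η) ≤ |w.im| * (|K| * |w.re|) := by gcongr
        linarith
    have hpos : 0 < (κ - ε) / |K| := by positivity
    rw [← ENNReal.ofReal_inv_of_pos (hpos.trans_le hprod)]
    refine ENNReal.ofReal_le_ofReal ?_
    rw [← inv_div]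
    exact inv_anti₀ hpos hprod
  have hlim : Tendsto (fun ε : ℝ => ENNReal.ofReal (|K| / (κ - ε))) (𝓝[>] 0)
      (𝓝 (ENNReal.ofReal (|K| / κ))) := by
    refine ENNReal.tendsto_ofReal ?_
    refine Tendsto.mono_left ?_ (inf_le_left (b := 𝓟 (Ioi (0 : ℝ))))
    have : ContinuousAt (fun ε : ℝ => |K| / (κ - ε)) 0 :=
      ContinuousAt.div (by fun_prop) (by fun_prop) (by simpa using hκ.ne')
    simpa [ContinuousAt] using this
  refine ge_of_tendsto hlim ?_
  filter_upwards [Ioo_mem_nhdsGT hκ] with ε hε using key ε hε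

/-- As `Re` tends to `0` the correction `E Re²` vanishes, so `|Re Im|` tends to `κ / |K| > 0`. This
forces `|Im|` to infinity, so the sequence tends along the filter of the limsup. -/
theorem le_lagrangeOfPeriods {P : Set ℂ} {K E κ : ℝ} (hK : K ≠ 0) (hκ : 0 < κ) (w : ℕ → ℂ)
    (hw : ∀ k, w k ∈ P) (hlim : Tendsto (fun k => (w k).re) atTop (𝓝 0))
    (hval : ∀ k, |K * ((w k).re * (w k).im) + E * (w k).re ^ 2| = κ) :
    ENNReal.ofReal (|K| / κ) ≤ lagrangeOfPeriods P := by
  have hK' : 0 < |K| := abs_pos.2 hK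
  have hre : ∀ k, (w k).re ≠ 0 := fun k h => by
    have := hval k
    simp [h] at this
    exact hκ.ne this
  have hprod : Tendsto (fun k => |(w k).re| * |(w k).im|) atTop (𝓝 (κ / |K|)) := by
    have h1 : Tendsto (fun k => |K * ((w k).re * (w k).im)|) atTop (𝓝 κ) := by
      rw [tendsto_iff_dist_tendsto_zero]
      refine squeeze_zero (g := fun k => |E * (w k).re ^ 2|) (fun _ => dist_nonneg) (fun k => ?_) ?_
      · rw [Real.dist_eq, ← hval k]
        refine (abs_abs_sub_abs_le _ _).trans (le_of_eq ?_)
        rw [← abs_neg]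
        congr 1
        ring
      · simpa using ((hlim.pow 2).const_mul E).abs
    have h2 := h1.div_const |K|
    refine h2.congr fun k => ?_
    rw [abs_mul, abs_mul]
    field_simp
  have him : Tendsto (fun k => |(w k).im|) atTop atTop := by
    have h1 : Tendsto (fun k => |(w k).re|⁻¹) atTop atTop := by
      refine tendsto_inv_nhdsGT_zero.comp (tendsto_nhdsWithin_iff.2 ⟨by simpa using hlim.abs, ?_⟩)
      exact Eventually.of_forall fun k => abs_pos.2 (hre k)
    refine (hprod.pos_mul_atTop (by positivity) h1).congr fun k => ?_
    have := abs_pos.2 (hre k)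
    field_simp
  have hF : Tendsto w atTop (comap (fun v : ℂ => |v.im|) atTop ⊓ 𝓟 P) :=
    tendsto_inf.2 ⟨tendsto_comap_iff.2 him, tendsto_principal.2 (Eventually.of_forall hw)⟩
  have hu : Tendsto (fun k => (ENNReal.ofReal (|(w k).re| * |(w k).im|))⁻¹) atTop
      (𝓝 (ENNReal.ofReal (|K| / κ))) := by
    rw [← inv_div, ENNReal.ofReal_inv_of_pos (by positivity)]
    exact (continuous_inv.tendsto _).comp (ENNReal.tendsto_ofReal hprod)
  rw [← hu.limsup_eq]
  exact limsup_le_limsup_of_le (u := fun v : ℂ => (ENNReal.ofReal (|v.re| * |v.im|))⁻¹) hF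

theorem rotated_re_im (n : ℕ) (α x y : ℝ) (v : ℂ) (hx : v.re = x) (hy : v.im = y) :
    (Complex.exp ((Real.arctan α : ℝ) * Complex.I) * (v / ((√(n : ℝ) : ℝ) : ℂ))).re
        = (x - α * y) / (√(1 + α ^ 2) * √n) ∧
      (Complex.exp ((Real.arctan α : ℝ) * Complex.I) * (v / ((√(n : ℝ) : ℝ) : ℂ))).im
        = (α * x + y) / (√(1 + α ^ 2) * √n) := by
  have e : Complex.exp ((Real.arctan α : ℝ) * Complex.I)
      = ((Real.cos (Real.arctan α) : ℝ) : ℂ) + ((Real.sin (Real.arctan α) : ℝ) : ℂ) * Complex.I := by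
    rw [Complex.exp_mul_I]
    push_cast
    rfl
  rw [e, Real.cos_arctan, Real.sin_arctan, Complex.mul_re, Complex.mul_im, Complex.div_ofReal_re,
    Complex.div_ofReal_im, hx, hy]
  simp only [Complex.add_re, Complex.add_im, Complex.ofReal_re, Complex.ofReal_im,
    Complex.re_ofReal_mul, Complex.im_ofReal_mul, Complex.I_re, Complex.I_im]
  constructor
  · rw [← div_div]; ring
  · rw [← div_div]; ring

/-- If the form `(x - α y) (x - α' y)` is bounded below by `κ` on the periods, and this value is
taken along a sequence of periods approaching the direction `α`, then `L` is `n |α - α'| / κ`. -/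
theorem lagrange_eq {n : ℕ} (hn : 0 < n) (S : Origami n) {α α' κ : ℝ} (hα : α ≠ α') (hκ : 0 < κ)
    (hlow : ∀ x y : ℤ, S.HasPeriod x y → κ ≤ |(x - α * y) * (x - α' * y)|) (p q : ℕ → ℤ)
    (hpq : ∀ k, S.HasPeriod (p k) (q k))
    (hlim : Tendsto (fun k => (p k : ℝ) - α * q k) atTop (𝓝 0))
    (hval : ∀ k, |((p k : ℝ) - α * q k) * (p k - α' * q k)| = κ) :
    S.lagrange α = ENNReal.ofReal (n * |α - α'| / κ) := by
  have hn' : (0 : ℝ) < n := by exact_mod_cast hn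
  set w : ℤ → ℤ → ℂ := fun x y =>
    Complex.exp ((Real.arctan α : ℝ) * Complex.I) * (gaussInt x y / ((√(n : ℝ) : ℝ) : ℂ)) with hw
  have hre : ∀ x y : ℤ, (w x y).re = ((x : ℝ) - α * y) / (√(1 + α ^ 2) * √n) := fun x y =>
    (rotated_re_im n α x y _ (gaussInt_re x y) (gaussInt_im x y)).1
  have him : ∀ x y : ℤ, (w x y).im = (α * (x : ℝ) + y) / (√(1 + α ^ 2) * √n) := fun x y =>
    (rotated_re_im n α x y _ (gaussInt_re x y) (gaussInt_im x y)).2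
  -- The coefficients come from writing `y` in the rotated coordinates and substituting in `x - α' y
  -- = (x - α y) + (α - α') y`.
  have hform : ∀ x y : ℤ, (n * (α - α')) * ((w x y).re * (w x y).im) +
      (n * (1 + α ^ 2 - (α - α') * α)) * (w x y).re ^ 2
        = ((x : ℝ) - α * y) * (x - α' * y) := by
    intro x y
    have h1 : √(1 + α ^ 2) ^ 2 = 1 + α ^ 2 := Real.sq_sqrt (by positivity)
    have h2 : √(n : ℝ) ^ 2 = n := Real.sq_sqrt hn'.le
    have h3 : (√(1 + α ^ 2) * √(n : ℝ)) ^ 2 = (1 + α ^ 2) * n := by rw [mul_pow, h1, h2]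
    have h4 : √(1 + α ^ 2) * √(n : ℝ) ≠ 0 := by positivity
    rw [hre, him, div_mul_div_comm, div_pow, ← sq, h3]
    have h5 : 1 + α ^ 2 ≠ 0 := by positivity
    field_simp
    ring
  have hmem : ∀ x y : ℤ, S.HasPeriod x y →
      w x y ∈ (fun v => Complex.exp ((Real.arctan α : ℝ) * Complex.I) * v) '' S.normHol :=
    fun x y h => ⟨_, ⟨_, h, rfl⟩, rfl⟩
  have hK : n * (α - α') ≠ 0 := mul_ne_zero hn'.ne' (sub_ne_zero.2 hα)
  have hKabs : |n * (α - α')| = n * |α - α'| := by rw [abs_mul, abs_of_pos hn']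
  rw [← hKabs]
  refine le_antisymm (lagrangeOfPeriods_le (E := n * (1 + α ^ 2 - (α - α') * α)) hK hκ ?_)
    (le_lagrangeOfPeriods (E := n * (1 + α ^ 2 - (α - α') * α)) hK hκ
      (fun k => w (p k) (q k)) (fun k => hmem _ _ (hpq k)) ?_ fun k => ?_)
  · rintro _ ⟨_, ⟨v, hv, rfl⟩, rfl⟩
    obtain ⟨x, y, rfl⟩ := S.exists_gaussInt_of_mem_hol hv
    have := hlow x y hv
    rwa [← hform] at this
  · simp only [hre]
    simpa using hlim.div_const (√(1 + α ^ 2) * √n)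
  · rw [hform, hval]

end Origami

/-- `lagrange_eq` for the orbit of a period under a contraction of the direction transverse to `α`
which preserves the form. -/
theorem Origami.lagrange_eq_of_contraction {n : ℕ} (hn : 0 < n) (S : Origami n) {α α' κ μ : ℝ}
    (hα : α ≠ α') (hκ : 0 < κ)
    (hlow : ∀ x y : ℤ, S.HasPeriod x y → κ ≤ |(x - α * y) * (x - α' * y)|)
    (F : ℤ × ℤ → ℤ × ℤ) (hF : ∀ v, S.HasPeriod v.1 v.2 → S.HasPeriod (F v).1 (F v).2)
    (hμ : |μ| < 1) (hFα : ∀ v, ((F v).1 : ℝ) - α * (F v).2 = μ * (v.1 - α * v.2))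
    (hform : ∀ v, (((F v).1 : ℝ) - α * (F v).2) * ((F v).1 - α' * (F v).2)
      = (v.1 - α * v.2) * (v.1 - α' * v.2))
    (v : ℤ × ℤ) (hv : S.HasPeriod v.1 v.2)
    (hval : |((v.1 : ℝ) - α * v.2) * (v.1 - α' * v.2)| = κ) :
    S.lagrange α = ENNReal.ofReal (n * |α - α'| / κ) := by
  refine lagrange_eq hn S hα hκ hlow (fun k => (F^[k] v).1) (fun k => (F^[k] v).2) (fun k => ?_) ?_
    fun k => ?_
  · induction k with
    | zero => exact hv
    | succ k ih =>
      simp only [Function.iterate_succ_apply']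
      exact hF _ ih
  · have : ∀ k, ((F^[k] v).1 : ℝ) - α * (F^[k] v).2 = μ ^ k * (v.1 - α * v.2) := by
      intro k
      induction k with
      | zero => simp
      | succ k ih =>
        rw [Function.iterate_succ_apply', hFα, ih]
        ring
    simp only [this]
    simpa using (tendsto_pow_atTop_nhds_zero_of_abs_lt_one hμ).mul_const ((v.1 : ℝ) - α * v.2)
  · induction k with
    | zero => exact hval
    | succ k ih => simpa only [Function.iterate_succ_apply', hform] using ih

/-! ### The two values of `L` -/

theorem lagrange_cuspC_six :
    (cuspC 6).lagrange ((-3 + √21) / 2) = ENNReal.ofReal (7 * √21 / 3) := by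
  have h21 : √21 ^ 2 = (21 : ℝ) := Real.sq_sqrt (by norm_num)
  have hpos : (0 : ℝ) < √21 := by positivity
  have hform : ∀ x y : ℤ, ((x : ℝ) - (-3 + √21) / 2 * y) * (x - (-3 - √21) / 2 * y)
      = ((x ^ 2 + 3 * x * y - 3 * y ^ 2 : ℤ) : ℝ) := by
    intro x y
    push_cast
    linear_combination (-(y : ℝ) ^ 2 / 4) * h21
  have hlt : √21 < (5 : ℝ) := by rw [Real.sqrt_lt' (by norm_num)]; norm_num
  have hgt : (4 : ℝ) < √21 := by rw [Real.lt_sqrt (by norm_num)]; norm_num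
  -- The map is `g⁻¹`, whose eigenvalue on `x - α y` is `μ = α - 1`; the period `(0, 1)` has value
  -- `-3`.
  rw [lagrange_eq_of_contraction (by norm_num) (cuspC 6) (α' := (-3 - √21) / 2) (κ := 3)
    (μ := (-3 + √21) / 2 - 1) (by intro h; linarith) (by norm_num) ?_
    (fun v => (-v.1 - 3 * v.2, -v.1 - 4 * v.2)) ?_ ?_ ?_ ?_ (0, 1) hasPeriod_cuspC_six_zero_one]
  · rw [show (-3 + √21) / 2 - (-3 - √21) / 2 = √21 by ring, abs_of_pos hpos]
    norm_num
  · rw [hform]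
    norm_num
  · intro x y h
    rw [hform]
    exact_mod_cast three_le_abs_form_of_hasPeriod h
  · intro v h
    refine (hasPeriod_cuspC_six _ _).1 ?_
    convert h using 1 <;> ring
  · rw [abs_lt]
    constructor <;> linarith
  · intro v
    push_cast
    linear_combination ((v.2 : ℝ) / 4) * h21
  · intro v
    rw [hform, hform]
    congr 1
    ring

theorem lagrange_cuspC_three :
    (cuspC 3).lagrange (-1 + √35 / 5) = ENNReal.ofReal (2 * √35) := by
  have h35 : √35 ^ 2 = (35 : ℝ) := Real.sq_sqrt (by norm_num)
  have hpos : (0 : ℝ) < √35 := by positivity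
  have hform : ∀ x y : ℤ, ((x : ℝ) - (-1 + √35 / 5) * y) * (x - (-1 - √35 / 5) * y)
      = ((5 * x ^ 2 + 10 * x * y - 2 * y ^ 2 : ℤ) : ℝ) / 5 := by
    intro x y
    push_cast
    linear_combination (-(y : ℝ) ^ 2 / 25) * h35
  have hlt : √35 < (6 : ℝ) := by rw [Real.sqrt_lt' (by norm_num)]; norm_num
  have hgt : (5 : ℝ) < √35 := by rw [Real.lt_sqrt (by norm_num)]; norm_num
  -- Here `κ = 7 / 5` because the integral form has leading coefficient `5`. The map is again `g⁻¹`,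
  -- with eigenvalue `5α - 1`, and `(1, -1)` has integral value `-7`.
  rw [lagrange_eq_of_contraction (by norm_num) (cuspC 3) (α' := -1 - √35 / 5) (κ := 7 / 5)
    (μ := -6 + √35) (by intro h; linarith) (by norm_num) ?_
    (fun v => (-v.1 - 2 * v.2, -5 * v.1 - 11 * v.2)) ?_ ?_ ?_ ?_ (1, -1)
    hasPeriod_cuspC_three_one_neg_one]
  · rw [show (-1 + √35 / 5) - (-1 - √35 / 5) = 2 * √35 / 5 by ring, abs_of_pos (by positivity)]
    congr 1
    push_cast
    ring
  · rw [hform]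
    norm_num [abs_div]
  · intro x y h
    rw [hform, abs_div, abs_of_pos (by norm_num : (0 : ℝ) < 5)]
    gcongr
    exact_mod_cast seven_le_abs_form_of_hasPeriod h
  · intro v h
    refine (hasPeriod_cuspC_three _ _).1 ?_
    convert h using 1 <;> ring
  · rw [abs_lt]
    constructor <;> linarith
  · intro v
    push_cast
    linear_combination ((v.2 : ℝ) / 5) * h35
  · intro v
    rw [hform, hform]
    congr 2
    ring

/-! ### Assembly of the even loops and of the closed formula for `phi1` -/

theorem isQuadraticIrrational_one_three : IsQuadraticIrrational (periodicCF [] [1, 3]) := by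
  refine ⟨?_, 1, 3, -3, by norm_num, ?_⟩
  · rw [periodicCF_one_three]
    rintro ⟨q, hq⟩
    refine irrational_sqrt_21 ⟨2 * q + 3, ?_⟩
    push_cast
    rw [hq]
    ring
  · have := periodicCF_two_quadratic (a := 1) (b := 3) (by norm_num) (by norm_num)
    push_cast at this ⊢
    linear_combination this

theorem isQuadraticIrrational_five_two : IsQuadraticIrrational (periodicCF [] [5, 2]) := by
  refine ⟨?_, 5, 10, -2, by norm_num, ?_⟩
  · rw [periodicCF_five_two]
    rintro ⟨q, hq⟩
    refine irrational_sqrt_35 ⟨5 * q + 5, ?_⟩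
    push_cast
    rw [hq]
    ring
  · have := periodicCF_two_quadratic (a := 5) (b := 2) (by norm_num) (by norm_num)
    push_cast at this ⊢
    linear_combination this

theorem isEvenLoop_cuspC_six : IsEvenLoop (cuspC 6) [1, 3] where
  mem := cuspC_six_mem_orbitB7
  ne_nil := by simp
  even := by decide
  pos := by decide
  quadratic := isQuadraticIrrational_one_three
  loop := isAffine_cuspC_six.isImage

theorem isEvenLoop_cuspC_three : IsEvenLoop (cuspC 3) [5, 2] where
  mem := cuspC_three_mem_orbitB7
  ne_nil := by simp
  even := by decide
  pos := by decide
  quadratic := isQuadraticIrrational_five_two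
  loop := isAffine_cuspC_three.isImage

theorem phi1_eq : phi1 = 7 * √21 / 3 := by
  rw [phi1, periodicCF_three_one]
  ring

end

theorem mainTheorem6 :
    (IsEvenLoop (cuspC 6) [1, 3] ∧ IsEvenLoop (cuspC 3) [5, 2]) ∧
    ((cuspC 6).lagrange (periodicCF [] [1, 3]) = ENNReal.ofReal phi1 ∧
      phi1 = 7 + 14 * periodicCF [] [3, 1] ∧ phi1 = 7 * Real.sqrt 21 / 3) ∧
    ((cuspC 3).lagrange (periodicCF [] [5, 2]) = ENNReal.ofReal (14 * periodicCF [1] [5, 2]) ∧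
      |14 * periodicCF [1] [5, 2] - 11.832159| ≤ (10 : ℝ) ^ (-6 : ℤ)) := by
  have h : 14 * periodicCF [1] [5, 2] = 2 * √35 := by rw [periodicCF_one_five_two]; ring
  refine ⟨⟨isEvenLoop_cuspC_six, isEvenLoop_cuspC_three⟩, ⟨?_, rfl, phi1_eq⟩, ?_, ?_⟩
  · rw [periodicCF_one_three, phi1_eq, lagrange_cuspC_six]
  · rw [periodicCF_five_two, h, lagrange_cuspC_three]
  -- Doubling this bracket gives `11.832158` and `11.83216`, exactly the ends of the allowed
  -- interval.
  · have h1 : (5.916079 : ℝ) ≤ √35 := Real.le_sqrt_of_sq_le (by norm_num)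
    have h2 : √35 ≤ (5.91608 : ℝ) := Real.sqrt_le_iff.2 (by norm_num)
    rw [h, abs_le]
    norm_num
    constructor <;> linarith
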